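/- Let $1<n_1<n_2<\cdots$ and $1=\ell_0<\ell_1<\ell_2<\cdots$ be integers such that $n_\ell>n_{\ell-1}+2\ell$ for all $\ell\ge 2$ and $(1+7^{-k})^{\ell_{k+1}-\ell_k}\ge 2$ for all $k\ge 0$. For $\ell\ge1$ let $k(\ell)$ be the unique $k\ge 0$ with $\ell_k\le \ell<\ell_{k+1}$. Cutting and stacking. Tower $0$ is the single level $[0,1)$, and $h_0=1$. Given tower $n$, whose $h_n$ levels are intervals of length $3^{-n}$, put $g_n=h_{n-k(\ell)}$ if $n=n_\ell$ for some $\ell\ge1$ and $g_n=0$ otherwise. Cut tower $n$ into three subcolumns of equal width, add $g_n$, $g_n+1$, $g_n$ extra intervals (spacers) of length $3^{-(n+1)}$ above the first, second and third subcolumn respectively, and stack the three subcolumns left under right to get tower $n+1$, of height $h_{n+1}=3h_n+3g_n+1$. The spacers are picked successively as the leftmost unused intervals of $\mathbb R_+$. The towers increase to $\mathbb R_+$. Sequence model. Let $p_n:\{0,\dots,h_{n+1}-1,\ast\}\to\{0,\dots,h_n-1,\ast\}$ be given by $p_n(\ast)=\ast$, $p_n(j)=j'$ if level $j$ of tower $n+1$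 lies in level $j'$ of tower $n$, and $p_n(j)=\ast$ if level $j$ of tower $n+1$ is a spacer. Let $X$ be the set of sequences $x=(j_n)_{n\ge0}$ with $j_n\in\{0,\dots,h_n-1,\ast\}$ and $j_n=p_n(j_{n+1})$ for all $n$, and not all $j_n$ equal to $\ast$, with the Borel $\sigma$-algebra of the product topology. For $x\in X$ there is a smallest $\overline n$ such that $j_n\in\{0,\dots,h_n-2\}$ for all $n\ge\overline n$; let $T(x)=(j'_n)_{n\ge 0}\in X$, where $j'_n=j_n+1$ for $n\ge\overline n$ and $j'_n=p_n(j'_{n+1})$ for $n<\overline n$. Let $\mu$ be the image of Lebesgue measure on $\mathbb R_+$ under the map sending $t$ to the sequence $(j_n(t))_n$, where $j_n(t)$ is the index of the level of tower $n$ containing $t$, or $\ast$ if there is none. The system $(X,\mu,T)$ is the nearly finite Chacon transformation. Let $L_0^0=\{x\in X: j_0=0\}$. Proposition. (1) The nearly finite Chacon transformation $(X,\mu,T)$ is rationally ergodic; that is, it is a conservative, ergodic, measure preserving system on a $\sigma$-finite measure space, and there are a measurable set $B$ with $0<\mu(B)<\infty$ and a constant $0<M<\infty$ such that for all $r\ge1$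 $$\int_B\Bigl(\sum_{0\le j\le r-1}\mathbf 1_B(T^jx)\Bigr)^2d\mu(x)\le M\Bigl(\int_B\sum_{0\le j\le r-1}\mathbf 1_B(T^jx)\,d\mu(x)\Bigr)^2 .$$ (2) One can take $B=L_0^0$: it is measurable, $0<\mu(L_0^0)<\infty$, and the inequality holds for $B=L_0^0$, some $0<M<\infty$ and all $r\ge1$. (3) $T$ admits a measurable law of large numbers: there is a measurable function $L:\{0,1\}^{\mathbb N}\to[0,\infty]$ such that for every measurable $B\subset X$, $L(\mathbf 1_B(x),\mathbf 1_B(Tx),\mathbf 1_B(T^2x),\dots)=\mu(B)$ for $\mu$-almost every $x$. -/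

import Mathlib

open MeasureTheory
open scoped ENNReal NNReal

/-! # Ergodic-theoretic notions -/

section ErgodicTheory

variable {Ω : Type*} [MeasurableSpace Ω]

/-- The occupation count `∑_{0 ≤ j ≤ r-1} 1_B (T^j x)`. -/
noncomputable def occupation (T : Ω → Ω) (B : Set Ω) (r : ℕ) (x : Ω) : ℝ≥0∞ :=
  ∑ j ∈ Finset.range r, B.indicator (fun _ => (1 : ℝ≥0∞)) (T^[j] x)

/-- `B` is a measurable set of positive finite measure on which the second moment of the occupation
counts is at most a (finite) constant times the square of the first moment, for all `r ≥ 1`. -/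
def RenyiInequality (T : Ω → Ω) (μ : Measure Ω) (B : Set Ω) : Prop :=
  MeasurableSet B ∧ 0 < μ B ∧ μ B < ∞ ∧
    ∃ M : ℝ≥0, 0 < M ∧ ∀ r : ℕ, 1 ≤ r →
      ∫⁻ x in B, occupation T B r x ^ 2 ∂μ ≤ M * (∫⁻ x in B, occupation T B r x ∂μ) ^ 2

/-- A rationally ergodic system: a conservative, ergodic, measure preserving dynamical system
(`Ergodic` contains measurability of `T` and invariance of `μ`) on a σ-finite space, possessing a set
`B` as in `RenyiInequality`. -/
structure RationallyErgodic (T : Ω → Ω) (μ : Measure Ω) : Prop where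
  sigmaFinite : SigmaFinite μ
  conservative : Conservative T μ
  ergodic : Ergodic T μ
  exists_renyi : ∃ B : Set Ω, RenyiInequality T μ B

/-- `L : {0,1}^ℕ → [0,∞]` is a measurable law of large numbers for `(Ω, μ, T)`. -/
def IsMeasurableLLN (T : Ω → Ω) (μ : Measure Ω) (L : (ℕ → Fin 2) → ℝ≥0∞) : Prop :=
  Measurable L ∧ ∀ B : Set Ω, MeasurableSet B →
    ∀ᵐ x ∂μ, L (fun j => B.indicator (fun _ => (1 : Fin 2)) (T^[j] x)) = μ B

end ErgodicTheory

/-! # The nearly finite Chacon transformation -/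

namespace NearlyFiniteChacon

/-- The two sequences of integers `1 < n_1 < n_2 < ⋯` and `1 = ℓ_0 < ℓ_1 < ⋯` that enter the
construction, with their growth conditions. The value `n 0` is not used. -/
structure Params where
  n : ℕ → ℕ
  l : ℕ → ℕ
  one_lt_n : 1 < n 1
  n_growth : ∀ ℓ, 2 ≤ ℓ → n (ℓ - 1) + 2 * ℓ < n ℓ
  l_zero : l 0 = 1
  l_strictMono : StrictMono l
  l_growth : ∀ k, (2 : ℝ) ≤ (1 + ((7 : ℝ) ^ k)⁻¹) ^ (l (k + 1) - l k)

namespace Params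

variable (P : Params)

/-- For `ℓ ≥ 1`, the unique `k` with `ℓ_k ≤ ℓ < ℓ_{k+1}`. -/
def k (ℓ : ℕ) : ℕ := Nat.findGreatest (fun k => P.l k ≤ ℓ) ℓ

theorem k_spec {ℓ : ℕ} (hℓ : 1 ≤ ℓ) : P.l (P.k ℓ) ≤ ℓ ∧ ℓ < P.l (P.k ℓ + 1) := by
  constructor
  · exact Nat.findGreatest_spec (P := fun k => P.l k ≤ ℓ) (m := 0) (Nat.zero_le _)
      (by rw [P.l_zero]; exact hℓ)
  · by_contra h
    have h : P.l (P.k ℓ + 1) ≤ ℓ := not_lt.mp h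
    have h1 : P.k ℓ + 1 ≤ P.l (P.k ℓ + 1) := P.l_strictMono.id_le _
    have h2 : P.k ℓ + 1 ≤ P.k ℓ :=
      Nat.le_findGreatest (P := fun k => P.l k ≤ ℓ) (h1.trans h) h
    omega

open Classical in
/-- The heights of the towers: `h_0 = 1`, `h_{n+1} = 3 h_n + 3 h_{n - k(ℓ)} + 1` if `n = n_ℓ` with
`ℓ ≥ 1`, and `h_{n+1} = 3 h_n + 1` otherwise. -/
noncomputable def height : ℕ → ℕ
  | 0 => 1
  | m + 1 => 3 * height m +
      3 * (if hm : ∃ ℓ, 1 ≤ ℓ ∧ P.n ℓ = m then height (m - P.k (Nat.find hm)) else 0) + 1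

open Classical in
/-- The number `h_{n - k(ℓ)}` (if `n = n_ℓ`) or `0` (otherwise) of extra intervals which are put
above each of the three subcolumns of tower `n`, besides the further one above the second. -/
noncomputable def pad (m : ℕ) : ℕ :=
  if hm : ∃ ℓ, 1 ≤ ℓ ∧ P.n ℓ = m then P.height (m - P.k (Nat.find hm)) else 0

theorem height_zero : P.height 0 = 1 := by rw [height]

theorem height_succ (m : ℕ) : P.height (m + 1) = 3 * P.height m + 3 * P.pad m + 1 := by
  rw [height, pad]

theorem n_lt_succ {ℓ : ℕ} (hℓ : 1 ≤ ℓ) : P.n ℓ + 2 * (ℓ + 1) < P.n (ℓ + 1) := by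
  simpa using P.n_growth (ℓ + 1) (by omega)

theorem lt_n {ℓ : ℕ} (hℓ : 1 ≤ ℓ) : ℓ < P.n ℓ := by
  induction ℓ, hℓ using Nat.le_induction with
  | base => exact P.one_lt_n
  | succ ℓ hℓ ih => have := P.n_lt_succ hℓ; omega

theorem n_lt_n {a b : ℕ} (ha : 1 ≤ a) (hab : a < b) : P.n a < P.n b := by
  induction b, hab using Nat.le_induction with
  | base => have := P.n_lt_succ ha; exact (by omega : P.n a < P.n (a + 1))
  | succ b hb ih => have := P.n_lt_succ (ℓ := b) (by omega); omega

theorem pad_n {ℓ : ℕ} (hℓ : 1 ≤ ℓ) : P.pad (P.n ℓ) = P.height (P.n ℓ - P.k ℓ) := by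
  classical
  have hm : ∃ ℓ', 1 ≤ ℓ' ∧ P.n ℓ' = P.n ℓ := ⟨ℓ, hℓ, rfl⟩
  have h1 : Nat.find hm = ℓ := by
    obtain ⟨h1, h2⟩ := Nat.find_spec hm
    rcases lt_trichotomy (Nat.find hm) ℓ with h | h | h
    · have := P.n_lt_n h1 h; omega
    · exact h
    · have := P.n_lt_n hℓ h; omega
  rw [pad, dif_pos hm]
  convert rfl using 4
  exact h1.symm

theorem height_pos (m : ℕ) : 0 < P.height m := by
  cases m with
  | zero => rw [height_zero]; exact one_pos
  | succ m => rw [height_succ]; omega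

/-- The map `p_n`, with `none` for the letter `∗`: `p_n(j) = j'` if level `j` of tower `n+1` lies
inside level `j'` of tower `n`, and `p_n(j) = ∗` if level `j` of tower `n+1` is a spacer. Tower `n+1`
consists, from bottom to top, of the first subcolumn of tower `n`, `pad n` spacers, the second
subcolumn, `pad n + 1` spacers, the third subcolumn, and `pad n` spacers. -/
noncomputable def p (m : ℕ) : Option ℕ → Option ℕ
  | none => none
  | some j =>
    let h := P.height m
    let g := P.pad m
    if j < h then some j
    else if j < h + g then none
    else if j < 2 * h + g then some (j - (h + g))
    else if j < 2 * h + 2 * g + 1 then none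
    else if j < 3 * h + 2 * g + 1 then some (j - (2 * h + 2 * g + 1))
    else none

theorem p_some_lt {m j i : ℕ} (hp : P.p m (some j) = some i) : i < P.height m := by
  simp only [p] at hp
  split_ifs at hp <;> simp only [Option.some.injEq] at hp <;> omega

theorem p_succ {m j i : ℕ} (hp : P.p m (some j) = some i) (hi : i + 1 < P.height m) :
    j + 1 < P.height (m + 1) ∧ P.p m (some (j + 1)) = some (i + 1) := by
  rw [height_succ]
  simp only [p] at hp ⊢
  split_ifs at hp <;> simp only [Option.some.injEq] at hp <;>
    (split_ifs <;> grind)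

theorem lt_of_pad_pos {m j i : ℕ} (hp : P.p m (some j) = some i) (hm : 0 < P.pad m) :
    j + 1 < P.height (m + 1) := by
  rw [height_succ]
  simp only [p] at hp
  split_ifs at hp <;> simp only [Option.some.injEq] at hp <;> omega

end Params

/-! ### The space and the transformation -/

/-- The alphabet `𝔸 = {∗} ∪ ℕ`, `none` being `∗`, with the discrete σ-algebra. -/
abbrev Letter : Type := Option ℕ

instance : MeasurableSpace Letter := ⊤

/-- The space `X` of sequences of letters, `j_n ∈ {0, …, h_n - 1} ∪ {∗}`, such that `j_n = p_n(j_{n+1})`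
for all `n`, and which are not identically `∗`. -/
def X (P : Params) : Type :=
  {x : ℕ → Letter // (∀ m j, x m = some j → j < P.height m) ∧
    (∀ m, x m = P.p m (x (m + 1))) ∧ ∃ m, x m ≠ none}

namespace X

variable {P : Params}

/-- The coordinate `j_n(x)`. -/
def coord (m : ℕ) (x : X P) : Option ℕ := x.1 m

/-- The σ-algebra of `X` is induced by the product σ-algebra. As the alphabet is countable and
discrete, this is the Borel σ-algebra of the topology induced by the product topology. -/
instance instMeasurableSpaceX : MeasurableSpace (X P) :=
  MeasurableSpace.comap (fun (x : X P) (m : ℕ) => (x.coord m : Letter)) MeasurableSpace.pi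

/-- The level `L_n^j` of tower `n`. -/
def level (P : Params) (m j : ℕ) : Set (X P) := {x | x.coord m = some j}

theorem coord_lt (x : X P) {m j : ℕ} (h : x.coord m = some j) : j < P.height m := x.2.1 m j h

theorem coord_eq (x : X P) (m : ℕ) : x.coord m = P.p m (x.coord (m + 1)) := x.2.2.1 m

theorem coord_some_succ (x : X P) {m i : ℕ} (h : x.coord m = some i) :
    ∃ j, x.coord (m + 1) = some j ∧ P.p m (some j) = some i := by
  have h1 := x.coord_eq m
  cases h2 : x.coord (m + 1) with
  | none => rw [h2, h] at h1; simp [Params.p] at h1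
  | some j => exact ⟨j, rfl, by rw [← h2, ← h1, h]⟩

theorem coord_some_of_le (x : X P) {m m' i : ℕ} (h : x.coord m = some i) (hm : m ≤ m') :
    ∃ j, x.coord m' = some j := by
  induction m', hm using Nat.le_induction with
  | base => exact ⟨i, h⟩
  | succ m' _ ih =>
    obtain ⟨j, hj⟩ := ih
    obtain ⟨j', hj', _⟩ := x.coord_some_succ hj
    exact ⟨j', hj'⟩

/-- For all large `n`, the coordinate `j_n` is in `{0, …, h_n - 2}`. -/
theorem exists_below_top (x : X P) :
    ∃ N, ∀ m, N ≤ m → ∃ j, x.coord m = some j ∧ j + 1 < P.height m := by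
  obtain ⟨m₀, hm₀⟩ := x.2.2.2
  obtain ⟨i₀, hi₀⟩ := Option.ne_none_iff_exists'.mp hm₀
  have hlt := P.lt_n (ℓ := m₀ + 1) (by omega)
  obtain ⟨i, hi⟩ := x.coord_some_of_le (m' := P.n (m₀ + 1)) hi₀ (by omega)
  refine ⟨P.n (m₀ + 1) + 1, fun m hm => ?_⟩
  induction m, hm using Nat.le_induction with
  | base =>
    obtain ⟨j, hj, hp⟩ := x.coord_some_succ hi
    refine ⟨j, hj, P.lt_of_pad_pos hp ?_⟩
    rw [P.pad_n (by omega)]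
    exact P.height_pos _
  | succ m _ ih =>
    obtain ⟨i, hi, hlt⟩ := ih
    obtain ⟨j, hj, hp⟩ := x.coord_some_succ hi
    exact ⟨j, hj, (P.p_succ hp hlt).1⟩

open Classical in
/-- The smallest `n̄` such that `j_n ∈ {0, …, h_n - 2}` for all `n ≥ n̄`. -/
noncomputable def nbar (x : X P) : ℕ := Nat.find x.exists_below_top

theorem nbar_spec (x : X P) {m : ℕ} (hm : x.nbar ≤ m) :
    ∃ j, x.coord m = some j ∧ j + 1 < P.height m := by
  classical
  exact Nat.find_spec x.exists_below_top m hm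

end X

/-- The composition `p_m ∘ p_{m+1} ∘ ⋯ ∘ p_{m+d-1}`. -/
noncomputable def descend (P : Params) : ℕ → ℕ → Option ℕ → Option ℕ
  | _, 0, a => a
  | m, d + 1, a => P.p m (descend P (m + 1) d a)

theorem descend_lt (P : Params) (m d : ℕ) (a : Option ℕ) {j : ℕ}
    (h : descend P m (d + 1) a = some j) : j < P.height m := by
  rw [descend] at h
  cases h' : descend P (m + 1) d a with
  | none => rw [h'] at h; simp [Params.p] at h
  | some i => rw [h'] at h; exact P.p_some_lt h

/-- The sequence `(j'_n)` with `j'_n = j_n + 1` for `n ≥ n̄`, the coordinates `j'_n` with `n < n̄`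
being given by `j'_n̄` and the compatibility conditions `j'_n = p_n(j'_{n+1})`. -/
noncomputable def succSeq {P : Params} (x : X P) (m : ℕ) : Letter :=
  if x.nbar ≤ m then (x.coord m).map (· + 1)
  else descend P m (x.nbar - m) ((x.coord x.nbar).map (· + 1))

/-- The nearly finite Chacon transformation. -/
noncomputable def T (P : Params) (x : X P) : X P :=
  ⟨succSeq x, by
    refine ⟨fun m j h => ?_, fun m => ?_, x.nbar, ?_⟩
    · rw [succSeq] at h
      split_ifs at h with hm
      · obtain ⟨i, hi, hlt⟩ := x.nbar_spec hm
        rw [hi] at h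
        have h : i + 1 = j := by simpa using h
        omega
      · obtain ⟨d, hd⟩ : ∃ d, x.nbar - m = d + 1 := ⟨x.nbar - m - 1, by omega⟩
        rw [hd] at h
        exact descend_lt P m d _ h
    · by_cases hm : x.nbar ≤ m
      · obtain ⟨i, hi, hlt⟩ := x.nbar_spec hm
        obtain ⟨j, hj, hp⟩ := x.coord_some_succ hi
        rw [succSeq, succSeq, if_pos hm, if_pos (by omega), hi, hj]
        exact (P.p_succ hp hlt).2.symm
      · rw [succSeq, succSeq, if_neg hm]
        by_cases hm' : x.nbar ≤ m + 1
        · have h : x.nbar = m + 1 := by omega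
          rw [if_pos hm', ← h, show x.nbar - m = 1 by omega]
          rfl
        · rw [if_neg hm', show x.nbar - m = (x.nbar - (m + 1)) + 1 by omega]
          rfl
    · obtain ⟨i, hi, hlt⟩ := x.nbar_spec le_rfl
      rw [succSeq, if_pos le_rfl, hi]
      exact Option.some_ne_none _⟩

/-! ### The measure -/

/-- Level `j` of tower `n`, in the cutting-and-stacking construction on `ℝ₊`, is the interval
`[a/3^n, (a+1)/3^n)` where `a = base n j`. The part of `ℝ₊` that is used up to tower `n` is
`[0, h_n/3^n)`. At step `n + 1` each level of tower `n` is cut into three pieces, and the spacers are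
picked successively, from bottom to top of tower `n+1`, as the leftmost available intervals of length
`1/3^(n+1)`, so that they are numbered `3 h_n, 3 h_n + 1, …` among the triadic intervals of rank
`n + 1`. -/
noncomputable def base (P : Params) : ℕ → ℕ → ℕ
  | 0, _ => 0
  | m + 1, j =>
    let h := P.height m
    let g := P.pad m
    if j < h then 3 * base P m j
    else if j < h + g then 3 * h + (j - h)
    else if j < 2 * h + g then 3 * base P m (j - (h + g)) + 1
    else if j < 2 * h + 2 * g + 1 then 3 * h + (j - 2 * h)
    else if j < 3 * h + 2 * g + 1 then 3 * base P m (j - (2 * h + 2 * g + 1)) + 2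
    else 3 * h + (j - 3 * h)

/-- Level `j` of tower `n` in `ℝ₊`. -/
noncomputable def interval (P : Params) (m j : ℕ) : Set ℝ :=
  Set.Ico ((base P m j : ℝ) / 3 ^ m) (((base P m j : ℝ) + 1) / 3 ^ m)

open Classical in
/-- The letter `j_n(t)`: the level of tower `n` containing `t`, or `∗` if there is none. -/
noncomputable def letter (P : Params) (t : ℝ) (m : ℕ) : Letter :=
  if ht : ∃ j, j < P.height m ∧ t ∈ interval P m j then some (Nat.find ht) else none

theorem base_lt (P : Params) (m : ℕ) {j : ℕ} (hj : j < P.height m) : base P m j < P.height m := by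
  induction m generalizing j with
  | zero => rw [P.height_zero]; simp [base]
  | succ m ih =>
    rw [P.height_succ] at *
    simp only [base]
    split_ifs with h1 h2 h3 h4 h5
    · have := ih h1; omega
    · omega
    · have := @ih (j - (P.height m + P.pad m)) (by omega); omega
    · omega
    · have := @ih (j - (2 * P.height m + 2 * P.pad m + 1)) (by omega); omega
    · omega

theorem base_inj (P : Params) (m : ℕ) {i j : ℕ} (hi : i < P.height m) (hj : j < P.height m)
    (h : base P m i = base P m j) : i = j := by
  induction m generalizing i j with
  | zero => rw [P.height_zero] at *; omega
  | succ m ih =>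
    rw [P.height_succ] at *
    have hlt := fun a => base_lt P m (j := a)
    have a1 := hlt i
    have a2 := hlt (i - (P.height m + P.pad m))
    have a3 := hlt (i - (2 * P.height m + 2 * P.pad m + 1))
    have b1 := hlt j
    have b2 := hlt (j - (P.height m + P.pad m))
    have b3 := hlt (j - (2 * P.height m + 2 * P.pad m + 1))
    simp only [base] at h
    split_ifs at h <;> first
      | omega
      | exact ih (by omega) (by omega) (by omega)
      | (have := @ih (i - (P.height m + P.pad m)) (j - (P.height m + P.pad m))
          (by omega) (by omega) (by omega)
         omega)
      | (have := @ih (i - (2 * P.height m + 2 * P.pad m + 1))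
          (j - (2 * P.height m + 2 * P.pad m + 1)) (by omega) (by omega) (by omega)
         omega)

theorem base_surj (P : Params) (m : ℕ) {a : ℕ} (ha : a < P.height m) :
    ∃ j, j < P.height m ∧ base P m j = a := by
  have hinj : Function.Injective
      (fun j : Fin (P.height m) => (⟨base P m j, base_lt P m j.2⟩ : Fin (P.height m))) := by
    intro i j h
    exact Fin.ext (base_inj P m i.2 j.2 (by simpa using h))
  obtain ⟨j, hj⟩ := Finite.surjective_of_injective hinj ⟨a, ha⟩
  exact ⟨j, j.2, by simpa using hj⟩

theorem mem_interval (P : Params) {m j : ℕ} {t : ℝ} (ht : 0 ≤ t) :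
    t ∈ interval P m j ↔ base P m j = ⌊t * 3 ^ m⌋₊ := by
  have h3 : (0 : ℝ) < 3 ^ m := by positivity
  rw [interval, Set.mem_Ico, div_le_iff₀ h3, lt_div_iff₀ h3, eq_comm,
    Nat.floor_eq_iff (by positivity)]

theorem letter_eq_some (P : Params) {m j : ℕ} {t : ℝ} (ht : 0 ≤ t) :
    letter P t m = some j ↔ j < P.height m ∧ t ∈ interval P m j := by
  classical
  rw [letter]
  split_ifs with h
  · obtain ⟨h1, h2⟩ := Nat.find_spec h
    constructor
    · intro h3
      rw [← Option.some.inj h3]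
      exact ⟨h1, h2⟩
    · rintro ⟨h3, h4⟩
      rw [mem_interval P ht] at h2 h4
      exact congrArg some (base_inj P m h1 h3 (h2.trans h4.symm))
  · constructor
    · intro h3; simp at h3
    · intro h3; exact absurd ⟨j, h3⟩ h

theorem letter_eq_none (P : Params) {m : ℕ} {t : ℝ} (ht : 0 ≤ t) :
    letter P t m = none ↔ P.height m ≤ ⌊t * 3 ^ m⌋₊ := by
  rw [Option.eq_none_iff_forall_ne_some]
  constructor
  · intro h
    by_contra hlt
    obtain ⟨j, hj, hb⟩ := base_surj P m (not_le.mp hlt)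
    exact h j ((letter_eq_some P ht).2 ⟨hj, (mem_interval P ht).2 hb⟩)
  · intro h j hj
    obtain ⟨hj, hb⟩ := (letter_eq_some P ht).1 hj
    rw [mem_interval P ht] at hb
    have := base_lt P m hj
    omega

/-- The level of tower `m` (or the absence of it) that contains level `j` of tower `m + 1` is the one
prescribed by `p_m`. -/
theorem base_div (P : Params) {m j : ℕ} (hj : j < P.height (m + 1)) :
    (∀ i, P.p m (some j) = some i → base P m i = base P (m + 1) j / 3) ∧
      (P.p m (some j) = none → P.height m ≤ base P (m + 1) j / 3) := by
  rw [P.height_succ] at hj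
  simp only [base, Params.p]
  split_ifs <;> refine ⟨fun i h => ?_, fun h => ?_⟩ <;> simp at h <;> subst_vars <;> omega

theorem floor_div (t : ℝ) (m : ℕ) : ⌊t * 3 ^ m⌋₊ = ⌊t * 3 ^ (m + 1)⌋₊ / 3 := by
  rw [← Nat.floor_div_natCast]
  congr 1
  push_cast
  ring

theorem letter_compat (P : Params) {t : ℝ} (ht : 0 ≤ t) (m : ℕ) :
    letter P t m = P.p m (letter P t (m + 1)) := by
  cases h : letter P t (m + 1) with
  | none =>
    rw [letter_eq_none P ht, P.height_succ] at h
    change letter P t m = none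
    rw [letter_eq_none P ht, floor_div]
    omega
  | some j =>
    obtain ⟨hj, hb⟩ := (letter_eq_some P ht).1 h
    rw [mem_interval P ht] at hb
    obtain ⟨h1, h2⟩ := base_div P hj
    cases hp : P.p m (some j) with
    | none =>
      rw [letter_eq_none P ht, floor_div, ← hb]
      exact h2 hp
    | some i =>
      rw [letter_eq_some P ht, mem_interval P ht, floor_div, ← hb]
      exact ⟨P.p_some_lt hp, h1 i hp⟩

/-- The Lebesgue measure `h_n/3^n` of tower `n`. -/
noncomputable def towerLength (P : Params) (m : ℕ) : ℝ := (P.height m : ℝ) / 3 ^ m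

theorem towerLength_pos (P : Params) (m : ℕ) : 0 < towerLength P m := by
  have : (0 : ℝ) < P.height m := by exact_mod_cast P.height_pos m
  rw [towerLength]; positivity

theorem towerLength_succ (P : Params) (m : ℕ) :
    towerLength P m + P.pad m / 3 ^ m ≤ towerLength P (m + 1) := by
  have h3 : (0 : ℝ) < 3 ^ m := by positivity
  rw [towerLength, towerLength, P.height_succ, ← add_div, pow_succ, div_le_div_iff₀ h3 (by positivity)]
  push_cast
  nlinarith

theorem towerLength_mono (P : Params) : Monotone (towerLength P) :=
  monotone_nat_of_le_succ fun m => by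
    have h1 := towerLength_succ P m
    have h2 : (0 : ℝ) ≤ P.pad m / 3 ^ m := by positivity
    linarith

theorem height_mono (P : Params) : Monotone P.height :=
  monotone_nat_of_le_succ fun m => by rw [P.height_succ]; omega

theorem pad_le (P : Params) (m : ℕ) : P.pad m ≤ P.height m := by
  classical
  rw [Params.pad]
  split_ifs
  · exact height_mono P (Nat.sub_le _ _)
  · exact Nat.zero_le _

theorem height_le (P : Params) (m d : ℕ) : P.height (m + d) ≤ 7 ^ d * P.height m := by
  induction d with
  | zero => simp
  | succ d ih =>
    have h1 := pad_le P (m + d)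
    have h2 := P.height_pos (m + d)
    rw [← Nat.add_assoc, P.height_succ, pow_succ]
    nlinarith

theorem k_le (P : Params) (ℓ : ℕ) : P.k ℓ ≤ ℓ := Nat.findGreatest_le _

theorem towerLength_n (P : Params) {ℓ k : ℕ} (hℓ : 1 ≤ ℓ) (h1 : P.l k ≤ ℓ) (h2 : ℓ < P.l (k + 1)) :
    towerLength P (P.n ℓ) * (1 + ((7 : ℝ) ^ k)⁻¹) ≤ towerLength P (P.n (ℓ + 1)) := by
  have hk : P.k ℓ = k := by
    obtain ⟨h3, h4⟩ := P.k_spec hℓ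
    have h5 := P.l_strictMono.lt_iff_lt.1 (h3.trans_lt h2)
    have h6 := P.l_strictMono.lt_iff_lt.1 (h1.trans_lt h4)
    omega
  have hlt := P.lt_n hℓ
  have hkl := k_le P ℓ
  have hh := height_le P (P.n ℓ - k) k
  rw [Nat.sub_add_cancel (by omega)] at hh
  have hh' : (P.height (P.n ℓ) : ℝ) ≤ 7 ^ k * P.height (P.n ℓ - k) := by exact_mod_cast hh
  have h7 := towerLength_succ P (P.n ℓ)
  rw [P.pad_n hℓ, hk] at h7
  have h8 : towerLength P (P.n ℓ + 1) ≤ towerLength P (P.n (ℓ + 1)) :=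
    towerLength_mono P (P.n_lt_n hℓ (Nat.lt_succ_self ℓ))
  refine le_trans ?_ (h7.trans h8)
  have h9 : (P.height (P.n ℓ) : ℝ) * ((7 : ℝ) ^ k)⁻¹ ≤ P.height (P.n ℓ - k) := by
    rw [← div_eq_mul_inv, div_le_iff₀ (by positivity)]
    linarith
  have h10 : (0 : ℝ) < 3 ^ P.n ℓ := by positivity
  calc towerLength P (P.n ℓ) * (1 + ((7 : ℝ) ^ k)⁻¹)
      = towerLength P (P.n ℓ) + (P.height (P.n ℓ) : ℝ) * ((7 : ℝ) ^ k)⁻¹ / 3 ^ P.n ℓ := by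
        rw [towerLength]; ring
    _ ≤ _ := by gcongr

theorem towerLength_pow (P : Params) (k d : ℕ) (hd : P.l k + d ≤ P.l (k + 1)) :
    towerLength P (P.n (P.l k)) * (1 + ((7 : ℝ) ^ k)⁻¹) ^ d ≤
      towerLength P (P.n (P.l k + d)) := by
  have hl : 1 ≤ P.l k := by
    rw [← P.l_zero]; exact P.l_strictMono.monotone (Nat.zero_le k)
  induction d with
  | zero => simp
  | succ d ih =>
    rw [pow_succ, ← mul_assoc, ← Nat.add_assoc]
    refine le_trans ?_ (towerLength_n P (k := k) (by omega) (by omega) (by omega))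
    gcongr
    exact ih (by omega)

theorem towerLength_unbounded (P : Params) (k : ℕ) :
    (2 : ℝ) ^ k ≤ towerLength P (P.n (P.l k)) := by
  induction k with
  | zero =>
    have h := towerLength_mono P (Nat.zero_le (P.n (P.l 0)))
    have h0 : towerLength P 0 = 1 := by simp [towerLength, P.height_zero]
    simpa [h0] using h
  | succ k ih =>
    have hl : P.l k < P.l (k + 1) := P.l_strictMono (Nat.lt_succ_self k)
    have h := towerLength_pow P k (P.l (k + 1) - P.l k) (by omega)
    rw [show P.l k + (P.l (k + 1) - P.l k) = P.l (k + 1) by omega] at h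
    refine le_trans ?_ h
    rw [pow_succ]
    exact mul_le_mul ih (P.l_growth k) (by norm_num) (towerLength_pos P _).le

/-- The towers exhaust `ℝ₊`. -/
theorem exists_letter_ne_none (P : Params) {t : ℝ} (ht : 0 ≤ t) : ∃ m, letter P t m ≠ none := by
  obtain ⟨k, hk⟩ := pow_unbounded_of_one_lt t (one_lt_two : (1 : ℝ) < 2)
  refine ⟨P.n (P.l k), ?_⟩
  rw [Ne, letter_eq_none P ht, not_le, Nat.floor_lt (by positivity)]
  have h := hk.trans_le (towerLength_unbounded P k)
  rw [towerLength, lt_div_iff₀ (by positivity)] at h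
  exact h

/-- The map `φ : ℝ₊ → X` given by `φ(t) = (j_n(t))_n`. -/
noncomputable def phi (P : Params) (t : Set.Ici (0 : ℝ)) : X P :=
  ⟨letter P t, fun _ _ h => ((letter_eq_some P t.2).1 h).1, letter_compat P t.2,
    exists_letter_ne_none P t.2⟩

/-- The measure `μ` on `X`: the pushforward by `φ` of the Lebesgue measure of `ℝ₊`. -/
noncomputable def mu (P : Params) : Measure (X P) :=
  Measure.map (phi P) (Measure.comap Subtype.val (volume : Measure ℝ))

end NearlyFiniteChacon

namespace NearlyFiniteChacon

open Filter Topology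

/-! ### Combinatorics of the towers -/

/-! Everything is read off the levels. They are nested or disjoint, they generate the σ-algebra,
each level of tower `n` has measure `3^{-n}`, and `T` moves a level onto the next one up. So
measures are compared on levels only (`mu_ext`). This gives invariance of `mu`. For an invariant set
`s`, the traces of `s` on the levels of one tower have equal measure, so `mu` restricted to `s` is a
multiple of `mu`, which is ergodicity. A set without returns meets tower `n` in measure at most
`3^{-n}`, which is conservativity.

The Rényi inequality with `B = L_0^0` comes from a pointwise bound. Let `h_n ≤ r < h_{n+1}`. Visits
to one level of tower `n` are at least `h_n` apart, `B` is a union of `3^n` such levels, and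
`h_{n+1} ≤ 7 h_n`, so no orbit visits `B` more than `8 · 3^n` times before `r`. Conversely the mean
count over `B` up to time `h_n` is at least `3^n / 2`, since each copy of `B` sees all the copies
above it. The count is thus at most 16 times its integral over `B` (`renyiInequality_base`).

For the law of large numbers, counts are observed at the times `t_ℓ = h_{n_ℓ+1+ℓ}`. No tower
strictly between `n_ℓ` and `n_{ℓ+1}` is padded, so inside tower `n_{ℓ+1}` the copies of tower
`n_ℓ+1` are separated by at most one spacer, and an orbit staying there up to `t_ℓ` visits all
levels of tower `n_ℓ+1` almost equally often (`normOcc_level_bounds`). By the growth of `n_ℓ` and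
Borel–Cantelli, almost every orbit stays there for all large `ℓ`. Hence the normalized counts of
every level converge to its measure. A maximal inequality (`measure_exists_lt_occupation_le`) makes
the counts of sets of small measure uniformly negligible, which carries the convergence to all
measurable sets. -/

/-- The three offsets are the heights at which the three subcolumns start. This form turns the
cascade of cases in `p` into linear arithmetic. -/
theorem Params.p_eq_some_iff (P : Params) {m a i : ℕ} :
    P.p m (some a) = some i ↔ i < P.height m ∧
      (a = i ∨ a = i + P.height m + P.pad m ∨ a = i + 2 * P.height m + 2 * P.pad m + 1) := by
  simp only [Params.p]
  split_ifs <;> simp only [Option.some.injEq, false_iff] <;> omega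

theorem Params.p_pred (P : Params) {m a j : ℕ} (h : P.p m (some a) = some (j + 1)) :
    ∃ b, a = b + 1 ∧ P.p m (some b) = some j := by
  obtain ⟨h1, h2⟩ := P.p_eq_some_iff.1 h
  refine ⟨a - 1, by omega, P.p_eq_some_iff.2 (by omega)⟩

theorem coord_eq_descend {P : Params} (x : X P) (m d : ℕ) :
    x.coord m = descend P m d (x.coord (m + d)) := by
  induction d generalizing m with
  | zero => rfl
  | succ d ih =>
    rw [descend, show m + (d + 1) = m + 1 + d by omega, ← ih (m + 1), x.coord_eq m]

theorem mem_level {P : Params} {x : X P} {m j : ℕ} : x ∈ X.level P m j ↔ x.coord m = some j :=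
  Iff.rfl

theorem level_eq_empty {P : Params} {m j : ℕ} (h : P.height m ≤ j) : X.level P m j = ∅ :=
  Set.eq_empty_of_forall_notMem fun _ hx => absurd (X.coord_lt _ hx) (by omega)

theorem level_disjoint {P : Params} {m i j : ℕ} (h : i ≠ j) :
    Disjoint (X.level P m i) (X.level P m j) :=
  Set.disjoint_left.2 fun _ hi hj => h (Option.some.inj ((mem_level.1 hi).symm.trans hj))

theorem level_succ_subset {P : Params} {m a i : ℕ} (h : P.p m (some a) = some i) :
    X.level P (m + 1) a ⊆ X.level P m i := fun x hx => by
  rw [mem_level] at hx ⊢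
  rw [x.coord_eq, hx, h]

theorem level_eq_union {P : Params} {m i : ℕ} (h : i < P.height m) :
    X.level P m i = X.level P (m + 1) i ∪ (X.level P (m + 1) (i + P.height m + P.pad m) ∪
      X.level P (m + 1) (i + 2 * P.height m + 2 * P.pad m + 1)) := by
  ext x
  simp only [Set.mem_union, mem_level]
  constructor
  · intro hx
    obtain ⟨a, ha, hp⟩ := x.coord_some_succ hx
    rw [ha]
    simpa using (P.p_eq_some_iff.1 hp).2
  · rintro (hx | hx | hx) <;> rw [x.coord_eq, hx, P.p_eq_some_iff] <;> omega

open Classical in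
/-- The levels of tower `p` that are contained in level `j` of tower `m`. -/
noncomputable def sublevels (P : Params) (m j p : ℕ) : Finset ℕ :=
  (Finset.range (P.height p)).filter fun i => descend P m (p - m) (some i) = some j

theorem mem_level_iff_sublevels {P : Params} {m j p : ℕ} (hp : m ≤ p) {x : X P} :
    x ∈ X.level P m j ↔ ∃ i ∈ sublevels P m j p, x ∈ X.level P p i := by
  obtain ⟨d, rfl⟩ := Nat.exists_eq_add_of_le hp
  simp only [sublevels, Finset.mem_filter, Finset.mem_range, Nat.add_sub_cancel_left, mem_level]
  constructor
  · intro h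
    obtain ⟨i, hi⟩ := x.coord_some_of_le h hp
    refine ⟨i, ⟨x.coord_lt hi, ?_⟩, hi⟩
    rw [← hi, ← coord_eq_descend, h]
  · rintro ⟨i, ⟨_, h⟩, hi⟩
    rw [coord_eq_descend x m d, hi, h]

theorem level_eq_biUnion {P : Params} {m j p : ℕ} (hp : m ≤ p) :
    X.level P m j = ⋃ i ∈ sublevels P m j p, X.level P p i := by
  ext x
  simp only [Set.mem_iUnion, exists_prop]
  exact mem_level_iff_sublevels hp

theorem level_subset_of_mem_sublevels {P : Params} {m j p i : ℕ} (hp : m ≤ p)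
    (hi : i ∈ sublevels P m j p) : X.level P p i ⊆ X.level P m j :=
  fun _ hx => (mem_level_iff_sublevels hp).2 ⟨i, hi, hx⟩

theorem lt_of_mem_sublevels {P : Params} {m j p i : ℕ} (hi : i ∈ sublevels P m j p) :
    i < P.height p :=
  Finset.mem_range.1 (Finset.mem_filter.1 hi).1

theorem level_inter {P : Params} {m j p i : ℕ} (hp : m ≤ p) :
    X.level P m j ∩ X.level P p i = X.level P p i ∨ X.level P m j ∩ X.level P p i = ∅ := by
  by_cases hi : i ∈ sublevels P m j p
  · exact Or.inl (Set.inter_eq_right.2 (level_subset_of_mem_sublevels hp hi))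
  · refine Or.inr (Set.eq_empty_of_forall_notMem fun x hx => hi ?_)
    obtain ⟨i', hi', hx'⟩ := (mem_level_iff_sublevels hp).1 hx.1
    rwa [← Option.some.inj ((mem_level.1 hx').symm.trans hx.2)]

/-- Levels are nested or disjoint, since a coordinate determines all earlier ones; this makes them a
π-system. -/
theorem level_inter_level {P : Params} (m j p i : ℕ) :
    (∃ q a, X.level P m j ∩ X.level P p i = X.level P q a) ∨
      X.level P m j ∩ X.level P p i = ∅ := by
  rcases le_total m p with h | h
  · exact (level_inter h).imp_left fun h => ⟨_, _, h⟩
  · rw [Set.inter_comm]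
    exact (level_inter h).imp_left fun h => ⟨_, _, h⟩

theorem three_pow_le_height (P : Params) (m d : ℕ) : 3 ^ d * P.height m ≤ P.height (m + d) := by
  induction d with
  | zero => simp
  | succ d ih => rw [← Nat.add_assoc, P.height_succ, pow_succ', Nat.mul_assoc]; omega

theorem lt_height (P : Params) (m : ℕ) : m < P.height m := by
  have := three_pow_le_height P 0 m
  rw [P.height_zero, Nat.zero_add] at this
  have := Nat.lt_pow_self (n := m) (by norm_num : 1 < 3)
  omega

/-! ### The action of `T` on the levels -/

/-- A point off the top level of tower `n` is off the top level of every later tower, by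
`Params.p_succ`. -/
theorem nbar_le {P : Params} {x : X P} {n j : ℕ} (h : x.coord n = some j)
    (hj : j + 1 < P.height n) : x.nbar ≤ n := by
  classical
  refine Nat.find_min' _ fun m hm => ?_
  induction m, hm using Nat.le_induction with
  | base => exact ⟨j, h, hj⟩
  | succ m _ ih =>
    obtain ⟨i, hi, hlt⟩ := ih
    obtain ⟨a, ha, hp⟩ := x.coord_some_succ hi
    exact ⟨a, ha, (P.p_succ hp hlt).1⟩

theorem T_coord_of_nbar_le {P : Params} {x : X P} {n : ℕ} (h : x.nbar ≤ n) :
    (T P x).coord n = (x.coord n).map (· + 1) :=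
  if_pos h

theorem T_coord {P : Params} {x : X P} {n j : ℕ} (h : x.coord n = some j)
    (hj : j + 1 < P.height n) : (T P x).coord n = some (j + 1) := by
  rw [T_coord_of_nbar_le (nbar_le h hj), h]; rfl

theorem coord_of_T_coord {P : Params} {x : X P} {n j : ℕ} (h : (T P x).coord n = some (j + 1)) :
    x.coord n = some j := by
  -- Climb to a tower beyond `nbar`, where `T` just adds one, and come back down with
  -- `Params.p_pred`.
  obtain ⟨d, hd⟩ : ∃ d, x.nbar ≤ n + d := ⟨x.nbar, by omega⟩
  induction d generalizing n j with
  | zero =>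
    obtain ⟨i, hi, _⟩ := x.nbar_spec (m := n) hd
    rw [T_coord_of_nbar_le (n := n) hd, hi] at h
    simpa [hi] using h
  | succ d ih =>
    obtain ⟨a, ha, hp⟩ := (T P x).coord_some_succ h
    obtain ⟨b, rfl, hb⟩ := P.p_pred hp
    rw [x.coord_eq, ih ha (by omega), hb]

theorem T_preimage_level_succ {P : Params} {n j : ℕ} (hj : j + 1 < P.height n) :
    T P ⁻¹' X.level P n (j + 1) = X.level P n j :=
  Set.ext fun _ => ⟨fun h => coord_of_T_coord h, fun h => T_coord h hj⟩

/-- Level `0` of tower `n` has three copies in tower `n + 1`. The upper two have a level right below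
them in that tower; only the preimage of the lowest is left to later towers. -/
theorem T_preimage_level_zero (P : Params) (n : ℕ) :
    T P ⁻¹' X.level P n 0 = X.level P (n + 1) (P.height n + P.pad n - 1) ∪
      X.level P (n + 1) (2 * P.height n + 2 * P.pad n) ∪ T P ⁻¹' X.level P (n + 1) 0 := by
  have h := P.height_pos n
  rw [level_eq_union h, ← T_preimage_level_succ (j := P.height n + P.pad n - 1),
    ← T_preimage_level_succ (j := 2 * P.height n + 2 * P.pad n)]
  · rw [show P.height n + P.pad n - 1 + 1 = 0 + P.height n + P.pad n by omega,
      show 2 * P.height n + 2 * P.pad n + 1 = 0 + 2 * P.height n + 2 * P.pad n + 1 by omega,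
      Set.preimage_union, Set.preimage_union, Set.union_comm]
  · rw [P.height_succ]; omega
  · rw [P.height_succ]; omega

theorem iterate_mem_level {P : Params} {x : X P} {n i s : ℕ} (h : x ∈ X.level P n i)
    (hs : i + s < P.height n) : (T P)^[s] x ∈ X.level P n (i + s) := by
  induction s with
  | zero => exact h
  | succ s ih =>
    rw [Function.iterate_succ_apply']
    exact T_coord (ih (by omega)) (by omega)

theorem mem_level_of_iterate {P : Params} {x : X P} {n i s : ℕ}
    (h : (T P)^[s] x ∈ X.level P n (i + s)) : x ∈ X.level P n i := by
  induction s generalizing x i with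
  | zero => exact h
  | succ s ih =>
    rw [Function.iterate_succ_apply] at h
    rw [mem_level]
    exact coord_of_T_coord (ih (i := i + 1) (by rwa [Nat.add_assoc i, Nat.add_comm 1 s]))

theorem iterate_preimage_level {P : Params} {n i s : ℕ} (hs : i + s < P.height n) :
    (T P)^[s] ⁻¹' X.level P n (i + s) = X.level P n i :=
  Set.ext fun _ => ⟨mem_level_of_iterate, fun h => iterate_mem_level h hs⟩

/-- Two distinct visits to a level of tower `n` are at least `h_n` units of time apart. -/
theorem height_le_return_time {P : Params} {x : X P} {n i d : ℕ} (h : x ∈ X.level P n i)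
    (hd : 0 < d) (h' : (T P)^[d] x ∈ X.level P n i) : P.height n ≤ d := by
  by_contra! hlt
  have hi := x.coord_lt h
  -- If `d ≤ i`, running back from `T^d x` puts `x` at height `i - d`. Otherwise the point at time
  -- `d - i` is at height `d` by climbing from `x`, and at height `0` by running back from `T^d x`.
  rcases le_or_gt d i with hdi | hdi
  · have h1 : x ∈ X.level P n (i - d) :=
      mem_level_of_iterate (s := d) (by rwa [Nat.sub_add_cancel hdi])
    have := Option.some.inj ((mem_level.1 h).symm.trans h1)
    omega
  · have h1 := iterate_mem_level (s := d - i) h (by omega)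
    have h2 : (T P)^[d - i] x ∈ X.level P n 0 := by
      refine mem_level_of_iterate (s := i) ?_
      rw [← Function.iterate_add_apply, Nat.zero_add, Nat.add_sub_cancel' hdi.le]
      exact h'
    have := Option.some.inj ((mem_level.1 h1).symm.trans h2)
    omega

/-! ### The measure of the levels and the invariance of `mu` -/

theorem measurable_coord {P : Params} (m : ℕ) :
    Measurable (fun x : X P => (x.coord m : Letter)) :=
  (measurable_pi_apply m).comp (comap_measurable _)

theorem measurableSet_level (P : Params) (m j : ℕ) : MeasurableSet (X.level P m j) :=
  measurable_coord m (MeasurableSet.of_discrete (s := {(some j : Letter)}))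

theorem measurable_of_coord {P : Params} {Ω : Type*} [MeasurableSpace Ω] {f : Ω → X P}
    (h : ∀ m j, MeasurableSet (f ⁻¹' X.level P m j)) : Measurable f := by
  refine measurable_comap_iff.2 (measurable_pi_iff.2 fun m => ?_)
  have hs : ∀ j, MeasurableSet ((fun ω => ((f ω).coord m : Letter)) ⁻¹' {some j}) :=
    fun j => h m j
  refine measurable_to_countable' (α := Letter) fun a => ?_
  cases a with
  | some j => exact hs j
  | none =>
    convert (MeasurableSet.iUnion hs).compl using 1
    ext ω
    simp [Option.eq_none_iff_forall_ne_some]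

/-- The collection of all levels of all towers. -/
def levels (P : Params) : Set (Set (X P)) := Set.range fun q : ℕ × ℕ => X.level P q.1 q.2

theorem isPiSystem_levels (P : Params) : IsPiSystem (levels P) := by
  rintro _ ⟨⟨m, j⟩, rfl⟩ _ ⟨⟨p, i⟩, rfl⟩ h
  rcases level_inter_level m j p i with ⟨q, a, h'⟩ | h'
  · exact ⟨(q, a), h'.symm⟩
  · exact absurd h' h.ne_empty

theorem generateFrom_levels (P : Params) :
    X.instMeasurableSpaceX (P := P) = MeasurableSpace.generateFrom (levels P) := by
  apply le_antisymm
  · have := @measurable_of_coord P (X P) (MeasurableSpace.generateFrom (levels P)) id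
      fun m j => MeasurableSpace.measurableSet_generateFrom ⟨(m, j), rfl⟩
    exact fun s hs => this hs
  · refine MeasurableSpace.generateFrom_le ?_
    rintro _ ⟨⟨m, j⟩, rfl⟩
    exact measurableSet_level P m j

theorem sUnion_levels (P : Params) : ⋃₀ levels P = Set.univ := by
  refine Set.eq_univ_of_forall fun x => ?_
  obtain ⟨m, hm⟩ := x.2.2.2
  obtain ⟨j, hj⟩ := Option.ne_none_iff_exists'.mp hm
  exact ⟨_, ⟨(m, j), rfl⟩, hj⟩

theorem countable_levels (P : Params) : (levels P).Countable := Set.countable_range _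

theorem phi_preimage_level (P : Params) {m j : ℕ} (hj : j < P.height m) :
    phi P ⁻¹' X.level P m j = Subtype.val ⁻¹' interval P m j := by
  ext t
  exact (letter_eq_some P t.2).trans (and_iff_right hj)

theorem measurable_phi (P : Params) : Measurable (phi P) := by
  refine measurable_of_coord fun m j => ?_
  rcases lt_or_ge j (P.height m) with h | h
  · rw [phi_preimage_level P h]
    exact measurable_subtype_coe measurableSet_Ico
  · rw [level_eq_empty h]
    exact MeasurableSet.empty

theorem mu_level (P : Params) {m j : ℕ} (hj : j < P.height m) :
    mu P (X.level P m j) = (3⁻¹ : ℝ≥0∞) ^ m := by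
  rw [mu, Measure.map_apply (measurable_phi P) (measurableSet_level P m j),
    phi_preimage_level P hj, comap_subtype_coe_apply measurableSet_Ici, Set.image_preimage_eq_inter_range,
    Subtype.range_coe, Set.inter_eq_left.2, interval, Real.volume_Ico, ← sub_div,
    add_sub_cancel_left, one_div, ← inv_pow, ENNReal.ofReal_pow (by norm_num),
    ENNReal.ofReal_inv_of_pos (by norm_num), ENNReal.ofReal_ofNat]
  exact fun t ht => le_trans (by positivity) ht.1

theorem mu_level_le (P : Params) (m j : ℕ) : mu P (X.level P m j) ≤ (3⁻¹ : ℝ≥0∞) ^ m := by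
  rcases lt_or_ge j (P.height m) with h | h
  · exact (mu_level P h).le
  · rw [level_eq_empty h, measure_empty]; exact zero_le

theorem mu_level_ne_top (P : Params) (m j : ℕ) : mu P (X.level P m j) ≠ ∞ :=
  ((mu_level_le P m j).trans_lt (by simp)).ne

theorem mu_level_ne_zero (P : Params) {m j : ℕ} (hj : j < P.height m) :
    mu P (X.level P m j) ≠ 0 := by
  rw [mu_level P hj]; simp

theorem sigmaFinite_mu (P : Params) : SigmaFinite (mu P) :=
  Measure.sigmaFinite_of_countable (countable_levels P)
    (by rintro _ ⟨⟨m, j⟩, rfl⟩; exact (mu_level_ne_top P m j).lt_top) (sUnion_levels P)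

/-- A measure is determined by the measure of the levels. -/
theorem mu_ext (P : Params) {ν ν' : Measure (X P)}
    (htop : ∀ m j, ν (X.level P m j) ≠ ∞)
    (h : ∀ m j, j < P.height m → ν (X.level P m j) = ν' (X.level P m j)) : ν = ν' := by
  refine Measure.ext_of_generateFrom_of_cover_subset (generateFrom_levels P) (isPiSystem_levels P)
    Set.Subset.rfl (countable_levels P) (sUnion_levels P) ?_ ?_
  · rintro _ ⟨⟨m, j⟩, rfl⟩
    exact htop m j
  · rintro _ ⟨⟨m, j⟩, rfl⟩
    rcases lt_or_ge j (P.height m) with hj | hj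
    · exact h m j hj
    · simp [level_eq_empty hj]

/-- Counted by measure: the sublevels partition a set of measure `3^{-m}` into pieces of measure
`3^{-(m+d)}`. -/
theorem card_sublevels (P : Params) {m j : ℕ} (hj : j < P.height m) (d : ℕ) :
    (sublevels P m j (m + d)).card = 3 ^ d := by
  have h := mu_level P hj
  rw [level_eq_biUnion (Nat.le_add_right m d), measure_biUnion_finset
    (fun i _ i' _ hne => level_disjoint hne) (fun i _ => measurableSet_level P _ i),
    Finset.sum_congr rfl fun i hi => mu_level P (lt_of_mem_sublevels hi), Finset.sum_const,
    nsmul_eq_mul, pow_add, mul_left_comm] at h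
  have h0 : (3⁻¹ : ℝ≥0∞) ^ m ≠ 0 := by simp
  have h1 : (3⁻¹ : ℝ≥0∞) ^ m ≠ ∞ := by simp
  have h2 : ((sublevels P m j (m + d)).card : ℝ≥0∞) * (3⁻¹) ^ d = 1 :=
    (ENNReal.mul_right_inj h0 h1).1 (h.trans (mul_one _).symm)
  rw [← ENNReal.inv_pow, ← div_eq_mul_inv, ENNReal.div_eq_one_iff (by simp) (by simp)] at h2
  exact_mod_cast h2

/-- The part of `T⁻¹ L_n^0` that lies outside of `T⁻¹ L_{n+1}^0`. -/
def preimageZeroPart (P : Params) (n : ℕ) : Set (X P) :=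
  X.level P (n + 1) (P.height n + P.pad n - 1) ∪ X.level P (n + 1) (2 * P.height n + 2 * P.pad n)

theorem measurableSet_preimageZeroPart (P : Params) (n : ℕ) :
    MeasurableSet (preimageZeroPart P n) :=
  (measurableSet_level P _ _).union (measurableSet_level P _ _)

theorem mu_preimageZeroPart (P : Params) (n : ℕ) :
    mu P (preimageZeroPart P n) = 2 * (3⁻¹ : ℝ≥0∞) ^ (n + 1) := by
  have h := P.height_pos n
  have h' := P.height_succ n
  rw [preimageZeroPart, measure_union (level_disjoint (by omega)) (measurableSet_level P _ _),
    mu_level P (by omega), mu_level P (by omega), two_mul]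

theorem preimageZeroPart_disjoint (P : Params) (n : ℕ) :
    Disjoint (preimageZeroPart P n) (T P ⁻¹' X.level P (n + 1) 0) := by
  have h := P.height_pos n
  have h' := P.height_succ n
  rw [preimageZeroPart, ← T_preimage_level_succ (j := P.height n + P.pad n - 1) (by omega),
    ← T_preimage_level_succ (j := 2 * P.height n + 2 * P.pad n) (by omega),
    ← Set.preimage_union]
  exact Disjoint.preimage _ (Set.disjoint_union_left.2
    ⟨level_disjoint (by omega), level_disjoint (by omega)⟩)

theorem T_preimage_level_zero_anti (P : Params) : Antitone fun n => T P ⁻¹' X.level P n 0 :=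
  antitone_nat_of_succ_le fun n => by
    rw [T_preimage_level_zero P n]; exact Set.subset_union_right

/-- A point in none of the parts would have its image at the bottom of every tower from `n` on,
whereas beyond `nbar` the coordinate of the image is a successor. -/
theorem T_preimage_level_zero_eq_iUnion (P : Params) (n : ℕ) :
    T P ⁻¹' X.level P n 0 = ⋃ m, preimageZeroPart P (n + m) := by
  apply Set.Subset.antisymm
  · intro x hx
    by_contra hne
    simp only [Set.mem_iUnion, not_exists] at hne
    have h : ∀ m, x ∈ T P ⁻¹' X.level P (n + m) 0 := fun m => by
      induction m with
      | zero => exact hx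
      | succ m ih =>
        rw [T_preimage_level_zero P (n + m)] at ih
        exact ih.resolve_left (hne m)
    obtain ⟨i, hi, _⟩ := x.nbar_spec (m := n + x.nbar) (by omega)
    have h1 := h x.nbar
    rw [Set.mem_preimage, mem_level, T_coord_of_nbar_le (by omega), hi] at h1
    simp at h1
  · refine Set.iUnion_subset fun m => ?_
    refine Set.Subset.trans ?_ (T_preimage_level_zero_anti P (Nat.le_add_right n m))
    simp only [T_preimage_level_zero P (n + m)]
    exact Set.subset_union_left

theorem preimageZeroPart_pairwise (P : Params) (n : ℕ) :
    Pairwise (Function.onFun Disjoint fun m => preimageZeroPart P (n + m)) := by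
  refine (pairwise_disjoint_on _).2 fun a b hab => ?_
  refine (preimageZeroPart_disjoint P (n + a)).mono_right ?_
  refine Set.Subset.trans ?_ (T_preimage_level_zero_anti P (show n + a + 1 ≤ n + b by omega))
  simp only [T_preimage_level_zero P (n + b)]
  exact Set.subset_union_left

theorem measurable_T (P : Params) : Measurable (T P) := by
  refine measurable_of_coord fun m j => ?_
  cases j with
  | zero =>
    rw [T_preimage_level_zero_eq_iUnion]
    exact MeasurableSet.iUnion fun m => measurableSet_preimageZeroPart P _
  | succ j =>
    rcases lt_or_ge (j + 1) (P.height m) with h | h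
    · rw [T_preimage_level_succ h]
      exact measurableSet_level P m j
    · rw [level_eq_empty h]
      exact MeasurableSet.empty

theorem mu_T_preimage_level (P : Params) {n j : ℕ} (hj : j < P.height n) :
    mu P (T P ⁻¹' X.level P n j) = (3⁻¹ : ℝ≥0∞) ^ n := by
  cases j with
  | zero =>
    rw [T_preimage_level_zero_eq_iUnion, measure_iUnion (preimageZeroPart_pairwise P n)
      fun m => measurableSet_preimageZeroPart P _]
    have h : ∀ m, mu P (preimageZeroPart P (n + m)) =
        2 * (3⁻¹ : ℝ≥0∞) ^ (n + 1) * (3⁻¹) ^ m := fun m => by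
      rw [mu_preimageZeroPart]; ring
    -- The geometric series `∑ 2 · 3^{-(n+1)} · 3^{-m}` sums to `3^{-n}`.
    simp_rw [h]
    rw [ENNReal.tsum_mul_left, ENNReal.tsum_geometric, pow_succ]
    have h2 : (1 - 3⁻¹ : ℝ≥0∞)⁻¹ = 3 * 2⁻¹ := by
      have h3 : (1 : ℝ≥0∞) - 3⁻¹ = 2 * 3⁻¹ := by
        refine ENNReal.sub_eq_of_eq_add (by simp) ?_
        rw [← add_one_mul, show (2 + 1 : ℝ≥0∞) = 3 by norm_num]
        exact (ENNReal.mul_inv_cancel (by simp) (by simp)).symm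
      rw [h3, ENNReal.mul_inv (by simp) (by simp), inv_inv, mul_comm]
    rw [h2]
    calc 2 * ((3⁻¹ : ℝ≥0∞) ^ n * 3⁻¹) * (3 * 2⁻¹) =
        (3⁻¹ : ℝ≥0∞) ^ n * ((3 * 3⁻¹) * (2 * 2⁻¹)) := by ring
      _ = _ := by
        rw [ENNReal.mul_inv_cancel (by simp) (by simp),
          ENNReal.mul_inv_cancel (by simp) (by simp), mul_one, mul_one]
  | succ j =>
    rw [T_preimage_level_succ hj, mu_level P (by omega)]

theorem measurePreserving_T (P : Params) : MeasurePreserving (T P) (mu P) (mu P) := by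
  refine ⟨measurable_T P, (mu_ext P (mu_level_ne_top P) fun m j hj => ?_).symm⟩
  rw [Measure.map_apply (measurable_T P) (measurableSet_level P m j), mu_T_preimage_level P hj,
    mu_level P hj]

/-! ### Conservativity and ergodicity -/

theorem mu_inter_level_of_preimage (P : Params) {s : Set (X P)} (hs : MeasurableSet s) {n i : ℕ}
    (hi : i < P.height n) :
    mu P ((T P)^[i] ⁻¹' s ∩ X.level P n 0) = mu P (s ∩ X.level P n i) := by
  have h := iterate_preimage_level (P := P) (n := n) (i := 0) (s := i) (by omega)
  rw [← h, ← Set.preimage_inter, Nat.zero_add]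
  exact ((measurePreserving_T P).iterate i).measure_preimage
    (hs.inter (measurableSet_level P n i)).nullMeasurableSet

/-- The union of the levels of tower `n`. -/
def tower (P : Params) (n : ℕ) : Set (X P) := ⋃ i ∈ Finset.range (P.height n), X.level P n i

theorem mem_tower {P : Params} {n : ℕ} {x : X P} : x ∈ tower P n ↔ ∃ i, x ∈ X.level P n i := by
  simp only [tower, Set.mem_iUnion, Finset.mem_range, exists_prop]
  exact ⟨fun ⟨i, _, h⟩ => ⟨i, h⟩, fun ⟨i, h⟩ => ⟨i, x.coord_lt h, h⟩⟩

theorem measurableSet_tower (P : Params) (n : ℕ) : MeasurableSet (tower P n) :=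
  Finset.measurableSet_biUnion _ fun i _ => measurableSet_level P n i

theorem tower_mono (P : Params) : Monotone (tower P) := fun m n hmn x hx => by
  obtain ⟨i, hi⟩ := mem_tower.1 hx
  obtain ⟨j, hj⟩ := x.coord_some_of_le hi hmn
  exact mem_tower.2 ⟨j, hj⟩

theorem iUnion_tower (P : Params) : ⋃ n, tower P n = Set.univ := by
  refine Set.eq_univ_of_forall fun x => ?_
  obtain ⟨m, hm⟩ := x.2.2.2
  obtain ⟨j, hj⟩ := Option.ne_none_iff_exists'.mp hm
  exact Set.mem_iUnion.2 ⟨m, mem_tower.2 ⟨j, hj⟩⟩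

theorem mu_inter_tower (P : Params) {s : Set (X P)} (hs : MeasurableSet s) (n : ℕ) :
    mu P (s ∩ tower P n) = ∑ i ∈ Finset.range (P.height n), mu P (s ∩ X.level P n i) := by
  rw [tower, Set.inter_iUnion₂, measure_biUnion_finset]
  · exact fun i _ j _ hij =>
      (level_disjoint hij).mono Set.inter_subset_right Set.inter_subset_right
  · exact fun i _ => hs.inter (measurableSet_level P n i)

theorem tendsto_mu_inter_tower (P : Params) (s : Set (X P)) :
    Tendsto (fun n => mu P (s ∩ tower P n)) atTop (𝓝 (mu P s)) := by
  have h := tendsto_measure_iUnion_atTop (μ := mu P) (s := fun n => s ∩ tower P n)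
    fun m n hmn => Set.inter_subset_inter_right s (tower_mono P hmn)
  rwa [← Set.inter_iUnion, iUnion_tower, Set.inter_univ] at h

theorem conservative_T (P : Params) : Conservative (T P) (mu P) := by
  refine ⟨(measurePreserving_T P).quasiMeasurePreserving, fun s hs h0 => ?_⟩
  by_contra! hne
  refine h0 ?_
  -- Pull every slice of `s` in tower `n` back to level `0`: without returns the pulled-back slices
  -- are disjoint, so their total measure is at most that of one level.
  have h : ∀ n, mu P (s ∩ tower P n) ≤ (3⁻¹ : ℝ≥0∞) ^ n := fun n => by
    rw [mu_inter_tower P hs, ← mu_level P (P.height_pos n)]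
    calc ∑ i ∈ Finset.range (P.height n), mu P (s ∩ X.level P n i)
        = ∑ i ∈ Finset.range (P.height n), mu P ((T P)^[i] ⁻¹' s ∩ X.level P n 0) :=
          Finset.sum_congr rfl fun i hi =>
            (mu_inter_level_of_preimage P hs (Finset.mem_range.1 hi)).symm
      _ = mu P (⋃ i ∈ Finset.range (P.height n), (T P)^[i] ⁻¹' s ∩ X.level P n 0) := by
          refine (measure_biUnion_finset ?_ fun i _ => ?_).symm
          · have key : ∀ i j, i < j → Disjoint ((T P)^[i] ⁻¹' s ∩ X.level P n 0)
                ((T P)^[j] ⁻¹' s ∩ X.level P n 0) := fun i j hij => by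
              refine Set.disjoint_left.2 fun x hx hy => hne _ hx.1 (j - i) (by omega) ?_
              rw [← Function.iterate_add_apply, Nat.sub_add_cancel hij.le]
              exact hy.1
            intro i _ j _ hij
            rcases lt_or_gt_of_ne hij with h | h
            · exact key i j h
            · exact (key j i h).symm
          · exact ((measurable_T P).iterate i hs).inter (measurableSet_level P n 0)
      _ ≤ mu P (X.level P n 0) :=
          measure_mono (Set.iUnion₂_subset fun _ _ => Set.inter_subset_right)
  refine le_antisymm (le_of_tendsto_of_tendsto' (tendsto_mu_inter_tower P s)
    (ENNReal.tendsto_pow_atTop_nhds_zero_of_lt_one ?_) h) zero_le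
  exact ENNReal.inv_lt_one.2 (by norm_num)

theorem mu_inter_level_eq_zero_level (P : Params) {s : Set (X P)} (hs : MeasurableSet s)
    (hT : T P ⁻¹' s = s) {n i : ℕ} (hi : i < P.height n) :
    mu P (s ∩ X.level P n i) = mu P (s ∩ X.level P n 0) := by
  rw [← mu_inter_level_of_preimage P hs hi]
  congr 2
  clear hi
  induction i with
  | zero => rfl
  | succ i ih => rw [Function.iterate_succ', Set.preimage_comp, hT, ih]

/-- Level `0` of tower `0` splits into `3^n` levels of tower `n`, and an invariant set takes the
same mass from each level of a tower. -/
theorem mu_inter_level_of_invariant (P : Params) {s : Set (X P)} (hs : MeasurableSet s)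
    (hT : T P ⁻¹' s = s) {n i : ℕ} (hi : i < P.height n) :
    mu P (s ∩ X.level P n i) = mu P (s ∩ X.level P 0 0) * (3⁻¹) ^ n := by
  have h0 : (mu P (s ∩ X.level P 0 0)) = 3 ^ n * mu P (s ∩ X.level P n i) := by
    rw [level_eq_biUnion (Nat.zero_le n), Set.inter_iUnion₂, measure_biUnion_finset,
      Finset.sum_congr rfl fun j hj => (mu_inter_level_eq_zero_level P hs hT
        (lt_of_mem_sublevels hj)).trans (mu_inter_level_eq_zero_level P hs hT hi).symm,
      Finset.sum_const, nsmul_eq_mul]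
    · have := card_sublevels P (m := 0) (j := 0) (P.height_pos 0) n
      rw [Nat.zero_add] at this
      rw [this]
      norm_cast
    · exact fun i _ j _ hij =>
        (level_disjoint hij).mono Set.inter_subset_right Set.inter_subset_right
    · exact fun i _ => hs.inter (measurableSet_level P n i)
  rw [h0, mul_comm, ← mul_assoc, ← mul_pow, ENNReal.inv_mul_cancel (by simp) (by simp), one_pow,
    one_mul]

theorem ergodic_T (P : Params) : Ergodic (T P) (mu P) := by
  refine ⟨measurePreserving_T P, ⟨fun s hs hT => ?_⟩⟩
  set c := mu P (s ∩ X.level P 0 0) with hc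
  have h : (mu P).restrict s = c • mu P := by
    refine mu_ext P (fun m j => ?_) fun m j hj => ?_
    · exact ((Measure.restrict_apply_le _ _).trans_lt (mu_level_ne_top P m j).lt_top).ne
    · rw [Measure.restrict_apply (measurableSet_level P m j), Set.inter_comm,
        mu_inter_level_of_invariant P hs hT hj, Measure.smul_apply, mu_level P hj, smul_eq_mul]
  rw [eventuallyConst_set']
  by_cases hc0 : c = 0
  · left
    rw [ae_eq_empty, ← Measure.restrict_apply_self, h, hc0, zero_smul, Measure.coe_zero,
      Pi.zero_apply]
  · right
    rw [ae_eq_univ]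
    -- Evaluated on `sᶜ`, the identity `(mu P).restrict s = c • mu P` reads `0 = c * mu P sᶜ`.
    have h1 : (mu P).restrict s sᶜ = c * mu P sᶜ := by rw [h]; rfl
    rw [Measure.restrict_apply hs.compl, Set.compl_inter_self, measure_empty] at h1
    exact (mul_eq_zero.1 h1.symm).resolve_left hc0

/-! ### Occupation counts and the Rényi inequality -/

open Classical in
/-- The set of times `s < r` at which the orbit of `x` visits `B`. -/
noncomputable def visits (P : Params) (B : Set (X P)) (r : ℕ) (x : X P) : Finset ℕ :=
  (Finset.range r).filter fun s => (T P)^[s] x ∈ B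

theorem mem_visits {P : Params} {B : Set (X P)} {r s : ℕ} {x : X P} :
    s ∈ visits P B r x ↔ s < r ∧ (T P)^[s] x ∈ B := by
  simp [visits]

theorem occupation_eq_card (P : Params) (B : Set (X P)) (r : ℕ) (x : X P) :
    occupation (T P) B r x = ((visits P B r x).card : ℝ≥0∞) := by
  classical
  rw [occupation, visits, Finset.card_filter, Nat.cast_sum]
  refine Finset.sum_congr rfl fun s _ => ?_
  by_cases h : (T P)^[s] x ∈ B <;> simp [h]

theorem card_visits_biUnion (P : Params) {ι : Type*} (J : Finset ι) (f : ι → Set (X P))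
    (hf : ∀ i ∈ J, ∀ j ∈ J, i ≠ j → Disjoint (f i) (f j)) (r : ℕ) (x : X P) :
    (visits P (⋃ i ∈ J, f i) r x).card = ∑ i ∈ J, (visits P (f i) r x).card := by
  classical
  rw [← Finset.card_biUnion]
  · congr 1
    ext s
    simp only [mem_visits, Finset.mem_biUnion, Set.mem_iUnion, exists_prop]
    tauto
  · exact fun i hi j hj hij => Finset.disjoint_left.2 fun s hs hs' =>
      Set.disjoint_left.1 (hf i hi j hj hij) (mem_visits.1 hs).2 (mem_visits.1 hs').2

theorem card_visits_level (P : Params) {m j p : ℕ} (hp : m ≤ p) (r : ℕ) (x : X P) :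
    (visits P (X.level P m j) r x).card =
      ∑ i ∈ sublevels P m j p, (visits P (X.level P p i) r x).card := by
  rw [level_eq_biUnion hp]
  exact card_visits_biUnion P _ _ (fun i _ i' _ h => level_disjoint h) r x

/-- Visits are at least `h_n` apart, so each block of `h_n` consecutive times contains at most one.
-/
theorem card_visits_level_le (P : Params) (n i r : ℕ) (x : X P) :
    (visits P (X.level P n i) r x).card ≤ r / P.height n + 1 := by
  rw [← Finset.card_range (r / P.height n + 1)]
  refine Finset.card_le_card_of_injOn (fun s => s / P.height n) (fun s hs => ?_) ?_
  · have := Nat.div_le_div_right (c := P.height n) (mem_visits.1 hs).1.le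
    simp only [Finset.coe_range, Set.mem_Iio]
    omega
  · have key : ∀ s s', s ∈ visits P (X.level P n i) r x → s' ∈ visits P (X.level P n i) r x →
        s / P.height n = s' / P.height n → s' ≤ s := fun s s' hs hs' h => by
      by_contra! hlt
      have h1 : P.height n ≤ s' - s := by
        refine height_le_return_time (mem_visits.1 hs).2 (by omega) ?_
        rw [← Function.iterate_add_apply, Nat.sub_add_cancel hlt.le]
        exact (mem_visits.1 hs').2
      have h2 := Nat.div_le_div_right (c := P.height n) (show s + P.height n ≤ s' by omega)
      rw [Nat.add_div_right _ (P.height_pos n)] at h2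
      omega
    exact fun s hs s' hs' h => le_antisymm (key s' s hs' hs h.symm) (key s s' hs hs' h)

theorem card_visits_base_le (P : Params) (n r : ℕ) (x : X P) :
    (visits P (X.level P 0 0) r x).card ≤ 3 ^ n * (r / P.height n + 1) := by
  have hc := card_sublevels P (m := 0) (j := 0) (P.height_pos 0) n
  rw [Nat.zero_add] at hc
  rw [card_visits_level P (Nat.zero_le n), ← hc, ← smul_eq_mul]
  exact Finset.sum_le_card_nsmul _ _ _ fun i _ => card_visits_level_le P n i r x

theorem measurable_occupation {Ω : Type*} [MeasurableSpace Ω] {f : Ω → Ω} (hf : Measurable f)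
    {B : Set Ω} (hB : MeasurableSet B) (r : ℕ) : Measurable (occupation f B r) :=
  Finset.measurable_sum _ fun j _ => (measurable_const.indicator hB).comp (hf.iterate j)

theorem card_filter_le_le_card_visits (P : Params) {n i : ℕ} {x : X P} (hx : x ∈ X.level P n i) :
    ((sublevels P 0 0 n).filter fun j => i ≤ j).card ≤
      (visits P (X.level P 0 0) (P.height n) x).card := by
  refine Finset.card_le_card_of_injOn (fun j => j - i) (fun j hj => ?_) fun j hj j' hj' h => ?_
  · obtain ⟨h1, h2⟩ := Finset.mem_filter.1 hj
    have h3 := lt_of_mem_sublevels h1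
    refine mem_visits.2 ⟨show j - i < _ by omega, level_subset_of_mem_sublevels (Nat.zero_le n) h1 ?_⟩
    have := iterate_mem_level (s := j - i) hx (by omega)
    rwa [Nat.add_sub_cancel' h2] at this
  · have h1 := (Finset.mem_filter.1 hj).2
    have h2 := (Finset.mem_filter.1 hj').2
    simp only at h
    omega

/-- By symmetry, at least half of the ordered pairs satisfy `i ≤ j`. -/
theorem sq_card_le_two_mul_sum (J : Finset ℕ) :
    J.card ^ 2 ≤ 2 * ∑ i ∈ J, (J.filter fun j => i ≤ j).card := by
  have h : ∑ i ∈ J, (J.filter fun j => i ≤ j).card = ∑ i ∈ J, (J.filter fun j => j ≤ i).card := by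
    simp_rw [Finset.card_filter]
    exact Finset.sum_comm
  rw [two_mul]
  nth_rw 2 [h]
  rw [← Finset.sum_add_distrib, sq, ← smul_eq_mul]
  refine Finset.card_nsmul_le_sum _ _ _ fun i _ => ?_
  rw [← Finset.card_union_add_card_inter, ← Finset.filter_or]
  rw [Finset.filter_true_of_mem fun j _ => le_total i j]
  omega

/-- From the copy of the base at height `i` in tower `n`, the orbit meets every copy at height `j ≥
i` before time `h_n`. Summing over the `3^n` copies, each of mass `3^{-n}`, gives at least `(3^n)^2
/ 2 · 3^{-n}`. -/
theorem three_pow_le_two_mul_lintegral_occupation (P : Params) (n : ℕ) :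
    (3 : ℝ≥0∞) ^ n ≤ 2 * ∫⁻ x in X.level P 0 0,
      occupation (T P) (X.level P 0 0) (P.height n) x ∂mu P := by
  set J := sublevels P 0 0 n with hJ
  have hc : J.card = 3 ^ n := by
    have hc := card_sublevels P (m := 0) (j := 0) (P.height_pos 0) n
    rwa [Nat.zero_add] at hc
  have h1 : ∑ i ∈ J, ((J.filter fun j => i ≤ j).card : ℝ≥0∞) * (3⁻¹) ^ n ≤
      ∫⁻ x in X.level P 0 0, occupation (T P) (X.level P 0 0) (P.height n) x ∂mu P := by
    rw [congrArg (mu P).restrict (level_eq_biUnion (P := P) (j := 0) (Nat.zero_le n)),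
      lintegral_biUnion_finset (fun i _ i' _ h => level_disjoint h)
      fun i _ => measurableSet_level P n i]
    refine Finset.sum_le_sum fun i hi => ?_
    rw [← mu_level P (lt_of_mem_sublevels hi), ← setLIntegral_const]
    refine setLIntegral_mono' (measurableSet_level P n i) fun x hx => ?_
    rw [occupation_eq_card]
    exact_mod_cast card_filter_le_le_card_visits P hx
  refine le_trans ?_ (mul_le_mul_right h1 2)
  have h2 : ((J.card ^ 2 : ℕ) : ℝ≥0∞) ≤
      ((2 * ∑ i ∈ J, (J.filter fun j => i ≤ j).card : ℕ) : ℝ≥0∞) := by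
    exact_mod_cast sq_card_le_two_mul_sum J
  rw [hc] at h2
  push_cast at h2
  rw [← Finset.sum_mul, ← mul_assoc]
  calc (3 : ℝ≥0∞) ^ n = (3 ^ n) ^ 2 * (3⁻¹) ^ n := by
        rw [sq, mul_assoc, ← mul_pow, ENNReal.mul_inv_cancel (by simp) (by simp), one_pow, mul_one]
    _ ≤ _ := mul_le_mul_left h2 _

theorem renyiInequality_base (P : Params) :
    RenyiInequality (T P) (mu P) (X.level P 0 0) := by
  refine ⟨measurableSet_level P 0 0, pos_iff_ne_zero.2 (mu_level_ne_zero P (P.height_pos 0)),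
    (mu_level_ne_top P 0 0).lt_top, 16, by norm_num, fun r hr => ?_⟩
  set B := X.level P 0 0
  obtain ⟨n, hn, hn'⟩ : ∃ n, P.height n ≤ r ∧ r < P.height (n + 1) := by
    refine ⟨Nat.findGreatest (fun n => P.height n ≤ r) r,
      Nat.findGreatest_spec (P := fun n => P.height n ≤ r) (Nat.zero_le r)
        (by rwa [P.height_zero]), ?_⟩
    by_contra! h
    have h1 := lt_height P (Nat.findGreatest (fun n => P.height n ≤ r) r + 1)
    have := Nat.le_findGreatest (P := fun n => P.height n ≤ r) (h1.le.trans h) h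
    omega
  have h7 : r / P.height n ≤ 7 := by
    have := height_le P n 1
    rw [pow_one] at this
    exact Nat.div_le_of_le_mul (by rw [Nat.mul_comm]; omega)
  -- The pointwise bound `8 · 3^n` uses `r / h_n + 1 ≤ 8`; the lower bound on the integral costs the
  -- other factor 2, whence 16.
  have hup : ∀ x, occupation (T P) B r x ≤ 16 * ∫⁻ x in B, occupation (T P) B r x ∂mu P :=
    fun x => by
    calc occupation (T P) B r x ≤ 8 * 3 ^ n := by
          rw [occupation_eq_card]
          have h1 := card_visits_base_le P n r x
          have h2 : 3 ^ n * (r / P.height n + 1) ≤ 8 * 3 ^ n := by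
            rw [Nat.mul_comm]; exact Nat.mul_le_mul_right _ (by omega)
          exact_mod_cast h1.trans h2
      _ ≤ 8 * (2 * ∫⁻ x in B, occupation (T P) B (P.height n) x ∂mu P) :=
          mul_le_mul_right (three_pow_le_two_mul_lintegral_occupation P n) 8
      _ ≤ 8 * (2 * ∫⁻ x in B, occupation (T P) B r x ∂mu P) := by
          refine mul_le_mul_right (mul_le_mul_right (lintegral_mono fun x => ?_) 2) 8
          exact Finset.sum_le_sum_of_subset (Finset.range_mono hn)
      _ = 16 * ∫⁻ x in B, occupation (T P) B r x ∂mu P := by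
          rw [← mul_assoc]; norm_num
  calc ∫⁻ x in B, occupation (T P) B r x ^ 2 ∂mu P
      ≤ ∫⁻ x in B, (16 * ∫⁻ x in B, occupation (T P) B r x ∂mu P) * occupation (T P) B r x
          ∂mu P := by
        refine lintegral_mono fun x => ?_
        simp only [sq]
        exact mul_le_mul_left (hup x) _
    _ = _ := by
        rw [lintegral_const_mul _ (measurable_occupation (measurable_T P)
          (measurableSet_level P 0 0) r), mul_assoc, ← sq]
        rfl

/-! ### The maximal ergodic inequality -/

section Maximal

variable {Ω : Type*}

/-- The maximum of the Birkhoff sums `∑_{j < k} g (f^j x)` over `0 ≤ k ≤ n`. -/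
noncomputable def maxBirkhoffSum (f : Ω → Ω) (g : Ω → ℝ) : ℕ → Ω → ℝ
  | 0, _ => 0
  | n + 1, x => max 0 (g x + maxBirkhoffSum f g n (f x))

theorem maxBirkhoffSum_nonneg (f : Ω → Ω) (g : Ω → ℝ) (n : ℕ) (x : Ω) :
    0 ≤ maxBirkhoffSum f g n x := by
  cases n
  · exact le_rfl
  · exact le_max_left _ _

theorem maxBirkhoffSum_le_succ (f : Ω → Ω) (g : Ω → ℝ) (n : ℕ) (x : Ω) :
    maxBirkhoffSum f g n x ≤ maxBirkhoffSum f g (n + 1) x := by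
  induction n generalizing x with
  | zero => exact maxBirkhoffSum_nonneg f g 1 x
  | succ n ih => exact max_le_max le_rfl (by gcongr; exact ih _)

theorem birkhoffSum_le_maxBirkhoffSum (f : Ω → Ω) (g : Ω → ℝ) (n : ℕ) (x : Ω) :
    birkhoffSum f g n x ≤ maxBirkhoffSum f g n x := by
  induction n generalizing x with
  | zero => simp [maxBirkhoffSum]
  | succ n ih =>
    rw [birkhoffSum_succ']
    exact le_max_of_le_right (by gcongr; exact ih _)

theorem occupation_eq_ofReal_birkhoffSum (f : Ω → Ω) (B : Set Ω) (n : ℕ) (x : Ω) :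
    occupation f B n x = ENNReal.ofReal (birkhoffSum f (B.indicator fun _ => (1 : ℝ)) n x) := by
  rw [occupation, birkhoffSum, ENNReal.ofReal_sum_of_nonneg
    fun j _ => Set.indicator_nonneg (fun _ _ => zero_le_one) _]
  refine Finset.sum_congr rfl fun j _ => ?_
  by_cases h : f^[j] x ∈ B <;> simp [h]

variable [MeasurableSpace Ω] {μ : Measure Ω} {f : Ω → Ω}

theorem measurable_maxBirkhoffSum (hf : Measurable f) {g : Ω → ℝ} (hg : Measurable g) (n : ℕ) :
    Measurable (maxBirkhoffSum f g n) := by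
  induction n with
  | zero => exact measurable_const
  | succ n ih => exact measurable_const.max (hg.add (ih.comp hf))

theorem integrable_maxBirkhoffSum (hf : MeasurePreserving f μ μ) {g : Ω → ℝ}
    (hg : Integrable g μ) (n : ℕ) : Integrable (maxBirkhoffSum f g n) μ := by
  induction n with
  | zero => exact integrable_zero _ _ _
  | succ n ih => exact (integrable_zero _ _ _).sup (hg.add (hf.integrable_comp_of_integrable ih))

/-- The maximal ergodic theorem. -/
theorem setIntegral_maxBirkhoffSum_pos_nonneg (hf : MeasurePreserving f μ μ) {g : Ω → ℝ}
    (hgm : Measurable g) (hg : Integrable g μ) (n : ℕ) :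
    0 ≤ ∫ x in {x | 0 < maxBirkhoffSum f g n x}, g x ∂μ := by
  set M := maxBirkhoffSum f g n with hM
  have hMm : Measurable M := measurable_maxBirkhoffSum hf.measurable hgm n
  have hMi : Integrable M μ := integrable_maxBirkhoffSum hf hg n
  have hMi' : Integrable (fun x => M (f x)) μ := hf.integrable_comp_of_integrable hMi
  have hE : MeasurableSet {x | 0 < M x} := measurableSet_lt measurable_const hMm
  have h0 : ∫ x, M (f x) ∂μ = ∫ x, M x ∂μ := by
    conv_rhs => rw [← hf.map_eq]
    exact (integral_map hf.measurable.aemeasurable hMm.aestronglyMeasurable).symm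
  have h1 : ∫ x in {x | 0 < M x}, M x ∂μ = ∫ x, M x ∂μ := by
    refine setIntegral_eq_integral_of_forall_compl_eq_zero fun x hx => ?_
    exact le_antisymm (not_lt.1 hx) (maxBirkhoffSum_nonneg f g n x)
  have h2 : ∫ x in {x | 0 < M x}, M (f x) ∂μ ≤ ∫ x, M (f x) ∂μ :=
    setIntegral_le_integral hMi' (ae_of_all _ fun x => maxBirkhoffSum_nonneg f g n (f x))
  calc (0 : ℝ) ≤ ∫ x in {x | 0 < M x}, M x ∂μ - ∫ x in {x | 0 < M x}, M (f x) ∂μ := by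
        rw [h1, ← h0]; linarith
    _ = ∫ x in {x | 0 < M x}, (M x - M (f x)) ∂μ :=
        (integral_sub hMi.integrableOn hMi'.integrableOn).symm
    _ ≤ _ := by
        refine setIntegral_mono_on (hMi.sub hMi').integrableOn hg.integrableOn hE fun x hx => ?_
        rw [sub_le_iff_le_add]
        -- Where the maximum is positive it is not attained by the empty sum, so it equals `g` plus
        -- the shorter maximum at `f x`.
        have hx : 0 < M x := hx
        cases n with
        | zero => exact absurd hx (lt_irrefl _)
        | succ n =>
          have h3 : M x = g x + maxBirkhoffSum f g n (f x) := by
            rcases max_choice 0 (g x + maxBirkhoffSum f g n (f x)) with h | h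
            · exact absurd hx (by rw [hM, maxBirkhoffSum, h]; exact lt_irrefl _)
            · exact h
          rw [h3]
          gcongr
          exact maxBirkhoffSum_le_succ f g n _

/-- The maximal inequality for ratios of occupation counts. -/
theorem measure_exists_lt_occupation_le (hf : MeasurePreserving f μ μ) {A D : Set Ω}
    (hA : MeasurableSet A) (hD : MeasurableSet D) (hAt : μ A ≠ ∞) (hDt : μ D ≠ ∞) (c : ℝ≥0) :
    c * μ (A ∩ {x | ∃ n, c * occupation f A n x < occupation f D n x}) ≤ μ D := by
  set a : Ω → ℝ := A.indicator fun _ => (1 : ℝ) with ha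
  set d : Ω → ℝ := D.indicator fun _ => (1 : ℝ) with hd
  set g : Ω → ℝ := fun x => d x - c * a x with hg
  have ham : Measurable a := measurable_const.indicator hA
  have hdm : Measurable d := measurable_const.indicator hD
  have hai : Integrable a μ := (integrable_indicator_iff hA).2 (integrableOn_const hAt)
  have hdi : Integrable d μ := (integrable_indicator_iff hD).2 (integrableOn_const hDt)
  have hgm : Measurable g := hdm.sub (ham.const_mul _)
  have hgi : Integrable g μ := hdi.sub (hai.const_mul _)
  set E : ℕ → Set Ω := fun n => {x | 0 < maxBirkhoffSum f g n x} with hE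
  have hEm : ∀ n, MeasurableSet (E n) := fun n =>
    measurableSet_lt measurable_const (measurable_maxBirkhoffSum hf.measurable hgm n)
  have hmono : Monotone fun n => A ∩ E n := monotone_nat_of_le_succ fun n x hx =>
    ⟨hx.1, lt_of_lt_of_le hx.2 (maxBirkhoffSum_le_succ f g n x)⟩
  -- The maximal theorem for `1_D - c 1_A` gives `c μ(A ∩ E n) ≤ μ(D ∩ E n)`.
  have h1 : ∀ n, c * μ (A ∩ E n) ≤ μ D := fun n => by
    have h2 := setIntegral_maxBirkhoffSum_pos_nonneg hf hgm hgi n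
    rw [integral_sub hdi.integrableOn (hai.const_mul _).integrableOn, integral_const_mul,
      ha, hd, setIntegral_indicator hA, setIntegral_indicator hD, setIntegral_const,
      setIntegral_const, smul_eq_mul, smul_eq_mul, mul_one, mul_one, sub_nonneg,
      Set.inter_comm _ A] at h2
    have h3 : c * μ.real (A ∩ E n) ≤ μ.real D :=
      h2.trans (measureReal_mono Set.inter_subset_right hDt)
    rw [← ENNReal.toReal_le_toReal _ hDt, ENNReal.toReal_mul]
    · exact h3
    · exact ENNReal.mul_ne_top ENNReal.coe_ne_top (measure_ne_top_of_subset Set.inter_subset_left hAt)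
  have h2 : A ∩ {x | ∃ n, c * occupation f A n x < occupation f D n x} ⊆ ⋃ n, A ∩ E n := by
    rintro x ⟨hxA, n, hn⟩
    refine Set.mem_iUnion.2 ⟨n, hxA, ?_⟩
    refine lt_of_lt_of_le ?_ (birkhoffSum_le_maxBirkhoffSum f g n x)
    rw [occupation_eq_ofReal_birkhoffSum, occupation_eq_ofReal_birkhoffSum,
      ← ENNReal.ofReal_coe_nnreal, ← ENNReal.ofReal_mul c.coe_nonneg] at hn
    have h4 := (ENNReal.ofReal_lt_ofReal_iff').1 hn
    have h5 : birkhoffSum f g n x = birkhoffSum f d n x - c * birkhoffSum f a n x := by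
      simp only [birkhoffSum, hg, Finset.sum_sub_distrib, Finset.mul_sum]
    rw [h5]
    exact sub_pos.2 h4.1
  calc c * μ (A ∩ {x | ∃ n, c * occupation f A n x < occupation f D n x})
      ≤ c * μ (⋃ n, A ∩ E n) := mul_le_mul_right (measure_mono h2) _
    _ ≤ μ D := le_of_tendsto'
        (ENNReal.Tendsto.const_mul (tendsto_measure_iUnion_atTop hmono)
          (Or.inr ENNReal.coe_ne_top)) h1

end Maximal

/-! ### Equidistribution of the visits along a sequence of times -/

theorem pad_eq_zero (P : Params) {ℓ i : ℕ} (hℓ : 1 ≤ ℓ) (h1 : P.n ℓ < i) (h2 : i < P.n (ℓ + 1)) :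
    P.pad i = 0 := by
  classical
  refine dif_neg ?_
  rintro ⟨ℓ', hℓ', rfl⟩
  rcases lt_trichotomy ℓ ℓ' with h | rfl | h
  · rcases Nat.lt_or_ge (ℓ + 1) ℓ' with h' | h'
    · have := P.n_lt_n (a := ℓ + 1) (by omega) h'; omega
    · obtain rfl : ℓ' = ℓ + 1 := by omega
      omega
  · omega
  · have := P.n_lt_n hℓ' h; omega

theorem descend_succ' (P : Params) (m d : ℕ) (a : Option ℕ) :
    descend P m (d + 1) a = descend P m d (P.p (m + d) a) := by
  induction d generalizing m with
  | zero => rfl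
  | succ d ih =>
    rw [descend, ih (m + 1), descend, show m + 1 + d = m + (d + 1) by omega]

theorem mem_sublevels_succ {P : Params} {m j q a b : ℕ} (hq : m ≤ q) (hb : b ∈ sublevels P m j q)
    (ha : P.p q (some a) = some b) : a ∈ sublevels P m j (q + 1) := by
  have h1 := P.p_eq_some_iff.1 ha
  have h2 := P.height_succ q
  simp only [sublevels, Finset.mem_filter, Finset.mem_range] at hb ⊢
  refine ⟨by omega, ?_⟩
  rw [Nat.succ_sub hq, descend_succ', Nat.add_sub_cancel' hq, ha, hb.2]

theorem mem_sublevels_self {P : Params} {m j : ℕ} (hj : j < P.height m) :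
    j ∈ sublevels P m j m := by
  simp [sublevels, hj, descend]

/-- If no tower between `m` and `q` is padded, then in tower `q` the gaps between two successive
copies of tower `m` contain at most one spacer: the first two statements locate the lowest and the
highest copy of level `i`, the third one finds a copy in each window of length `h_m + 1`. -/
theorem window_meets_sublevels (P : Params) {m i : ℕ} (hi : i < P.height m) (d : ℕ)
    (hpad : ∀ q, m ≤ q → q < m + d → P.pad q = 0) :
    i ∈ sublevels P m i (m + d) ∧
      i + (P.height (m + d) - P.height m) ∈ sublevels P m i (m + d) ∧
      ∀ y, y + P.height m + 1 ≤ P.height (m + d) →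
        ∃ s ≤ P.height m, y + s ∈ sublevels P m i (m + d) := by
  induction d with
  | zero =>
    refine ⟨mem_sublevels_self hi, ?_, fun y hy => ?_⟩
    · simpa using mem_sublevels_self hi
    · have hy : y + P.height m + 1 ≤ P.height m := hy
      omega
  | succ d ih =>
    obtain ⟨hbot, htop, hwin⟩ := ih fun q h1 h2 => hpad q h1 (by omega)
    have hg := hpad (m + d) (by omega) (by omega)
    have hH := P.height_succ (m + d)
    have hle : P.height m ≤ P.height (m + d) := height_mono P (by omega)
    have h0 : ∀ b ∈ sublevels P m i (m + d), b ∈ sublevels P m i (m + d + 1) := fun b hb =>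
      mem_sublevels_succ (by omega) hb
        (P.p_eq_some_iff.2 ⟨lt_of_mem_sublevels hb, Or.inl rfl⟩)
    have h1 : ∀ b ∈ sublevels P m i (m + d), b + P.height (m + d) ∈
        sublevels P m i (m + d + 1) := fun b hb =>
      mem_sublevels_succ (by omega) hb
        (P.p_eq_some_iff.2 ⟨lt_of_mem_sublevels hb, Or.inr (Or.inl (by omega))⟩)
    have h2 : ∀ b ∈ sublevels P m i (m + d), b + 2 * P.height (m + d) + 1 ∈
        sublevels P m i (m + d + 1) := fun b hb =>
      mem_sublevels_succ (by omega) hb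
        (P.p_eq_some_iff.2 ⟨lt_of_mem_sublevels hb, Or.inr (Or.inr (by omega))⟩)
    rw [hg] at hH
    rw [← Nat.add_assoc]
    set V := sublevels P m i (m + d + 1) with hV
    set H := P.height (m + d) with hHdef
    have key : ∀ y z, y ≤ z → z ≤ y + P.height m → z ∈ V → ∃ s ≤ P.height m, y + s ∈ V :=
      fun y z hyz hzy hz => ⟨z - y, by omega, by rwa [Nat.add_sub_cancel' hyz]⟩
    refine ⟨h0 i hbot, ?_, fun y hy => ?_⟩
    · convert h2 _ htop using 1
      omega
    -- The window lies in one of the three subcolumns or straddles a junction. At a junction, the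
    -- top copy below it or the bottom copy above it is met; the spacer at the second junction is
    -- why the window needs length `h_m + 1`.
    · rcases Nat.lt_or_ge (y + P.height m) H with c1 | c1
      · obtain ⟨s, hs, hs'⟩ := hwin y (by omega)
        exact ⟨s, hs, h0 _ hs'⟩
      rcases Nat.lt_or_ge y H with c2 | c2
      · rcases Nat.lt_or_ge (i + (H - P.height m)) y with c3 | c3
        · exact key y _ (by omega) (by omega) (h1 _ hbot)
        · exact key y _ (by omega) (by omega) (h0 _ htop)
      rcases Nat.lt_or_ge (y + P.height m) (2 * H) with c3 | c3
      · obtain ⟨s, hs, hs'⟩ := hwin (y - H) (by omega)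
        exact key y _ (by omega) (by omega) (h1 _ hs')
      rcases Nat.lt_or_ge y (2 * H + 1) with c4 | c4
      · rcases Nat.lt_or_ge (i + (H - P.height m) + H) y with c5 | c5
        · exact key y _ (by omega) (by omega) (h2 _ hbot)
        · exact key y _ (by omega) (by omega) (h1 _ htop)
      · obtain ⟨s, hs, hs'⟩ := hwin (y - (2 * H + 1)) (by omega)
        exact key y _ (by omega) (by omega) (h2 _ hs')

/-- The stretch of orbit stays in tower `m + d` and contains `t / (h_m + 1)` disjoint windows of
length `h_m + 1`, each with a visit. -/
theorem le_card_visits (P : Params) {m i d y t : ℕ} (hi : i < P.height m)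
    (hpad : ∀ q, m ≤ q → q < m + d → P.pad q = 0) {x : X P} (hx : x ∈ X.level P (m + d) y)
    (hy : y + t ≤ P.height (m + d)) :
    t / (P.height m + 1) ≤ (visits P (X.level P m i) t x).card := by
  nth_rw 1 [← Finset.card_range (t / (P.height m + 1))]
  refine Finset.card_le_card_of_surjOn (fun s => s / (P.height m + 1)) fun k hk => ?_
  have hk : k + 1 ≤ t / (P.height m + 1) := Finset.mem_range.1 hk
  rw [Nat.le_div_iff_mul_le (Nat.succ_pos _), Nat.succ_eq_add_one, Nat.add_mul, one_mul] at hk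
  obtain ⟨s, hs, hs'⟩ := (window_meets_sublevels P hi d hpad).2.2 (y + k * (P.height m + 1))
    (by omega)
  refine ⟨k * (P.height m + 1) + s, mem_visits.2 ⟨by omega, ?_⟩, ?_⟩
  · refine level_subset_of_mem_sublevels (Nat.le_add_right m d) hs' ?_
    rw [Nat.add_assoc]
    exact iterate_mem_level hx (by omega)
  · simp only
    rw [Nat.mul_comm, Nat.mul_add_div (Nat.succ_pos _), Nat.div_eq_of_lt (by omega), Nat.add_zero]

/-- Without padding no spacer is put above the third subcolumn, so the top `h_m` levels of tower `m
+ d` form a full copy of tower `m`. -/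
theorem coord_of_top (P : Params) {m d y : ℕ} (hpad : ∀ q, m ≤ q → q < m + d → P.pad q = 0)
    {x : X P} (hx : x ∈ X.level P (m + d) y) (hy : P.height (m + d) - P.height m ≤ y) :
    x ∈ X.level P m (y - (P.height (m + d) - P.height m)) := by
  induction d generalizing y with
  | zero => simpa using hx
  | succ d ih =>
    have hg := hpad (m + d) (by omega) (by omega)
    have hH := P.height_succ (m + d)
    have hle : P.height m ≤ P.height (m + d) := height_mono P (by omega)
    have hlt := x.coord_lt hx
    rw [← Nat.add_assoc] at hx hlt hy ⊢
    have h1 : x ∈ X.level P (m + d) (y - (2 * P.height (m + d) + 1)) :=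
      level_succ_subset (P.p_eq_some_iff.2 (by omega)) hx
    have h2 := ih (fun q h1 h2 => hpad q h1 (by omega)) h1 (by omega)
    rwa [show y - (P.height (m + d + 1) - P.height m) =
      y - (2 * P.height (m + d) + 1) - (P.height (m + d) - P.height m) by omega]

/-- The time scale `h_{n_ℓ + 1 + ℓ}`. -/
noncomputable def time (P : Params) (ℓ : ℕ) : ℕ := P.height (P.n ℓ + 1 + ℓ)

/-- The number of disjoint windows of length `h_{n_ℓ + 1} + 1` up to time `time P ℓ`. -/
noncomputable def windows (P : Params) (ℓ : ℕ) : ℕ := time P ℓ / (P.height (P.n ℓ + 1) + 1)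

/-- The points of tower `n_{ℓ+1}` which leave that tower before time `time P ℓ`. -/
def leaving (P : Params) (ℓ : ℕ) : Set (X P) :=
  {x | ∃ y, x.coord (P.n (ℓ + 1)) = some y ∧ P.height (P.n (ℓ + 1)) < y + time P ℓ}

/-- Leaving points lie in the top copy of tower `n_ℓ + 1 + ℓ` inside tower `n_{ℓ+1}`. There each
sublevel of the given level occupies a single level of tower `n_{ℓ+1}`, and the growth of `n_ℓ`
makes these levels thin enough. -/
theorem mu_leaving_inter_level_le (P : Params) {m j ℓ : ℕ} (hℓ : 1 ≤ ℓ) (hm : m ≤ ℓ) :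
    mu P (leaving P ℓ ∩ X.level P m j) ≤ (3⁻¹ : ℝ≥0∞) ^ ℓ := by
  rcases Nat.lt_or_ge j (P.height m) with hj | hj
  swap
  · rw [level_eq_empty hj, Set.inter_empty, measure_empty]; exact zero_le
  have hn := P.n_lt_succ hℓ
  have hn' := P.lt_n hℓ
  obtain ⟨d, hd⟩ : ∃ d, P.n (ℓ + 1) = P.n ℓ + 1 + ℓ + d :=
    ⟨P.n (ℓ + 1) - (P.n ℓ + 1 + ℓ), by omega⟩
  have hpad : ∀ q, P.n ℓ + 1 + ℓ ≤ q → q < P.n ℓ + 1 + ℓ + d → P.pad q = 0 := fun q h1 h2 =>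
    pad_eq_zero P hℓ (by omega) (by omega)
  obtain ⟨e, he⟩ : ∃ e, P.n ℓ + 1 + ℓ = m + e := ⟨P.n ℓ + 1 + ℓ - m, by omega⟩
  have hsub : leaving P ℓ ∩ X.level P m j ⊆ ⋃ i ∈ sublevels P m j (m + e),
      X.level P (P.n (ℓ + 1)) (i + (P.height (P.n (ℓ + 1)) - time P ℓ)) := by
    rintro x ⟨⟨y, hy, hlt⟩, hx⟩
    obtain ⟨i, hi, hxi⟩ := (mem_level_iff_sublevels (Nat.le_add_right m e)).1 hx
    refine Set.mem_iUnion₂.2 ⟨i, hi, ?_⟩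
    have hy' := hy
    rw [time, hd] at *
    have h1 := coord_of_top P hpad hy (by omega)
    rw [he] at h1
    have h2 := Option.some.inj ((mem_level.1 h1).symm.trans hxi)
    rw [mem_level, hy']
    congr 1
    rw [← he] at h2
    omega
  refine (measure_mono hsub).trans ((measure_biUnion_finset_le _ _).trans ?_)
  refine (Finset.sum_le_card_nsmul _ _ _ fun i _ => mu_level_le P _ _).trans ?_
  rw [card_sublevels P hj, nsmul_eq_mul]
  push_cast
  calc (3 : ℝ≥0∞) ^ e * (3⁻¹) ^ P.n (ℓ + 1) ≤ 3 ^ e * (3⁻¹) ^ (e + ℓ) :=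
        mul_le_mul_right (pow_le_pow_right_of_le_one' (ENNReal.inv_le_one.2 (by norm_num))
          (by omega)) _
    _ = _ := by
        rw [pow_add, ← mul_assoc, ← mul_pow, ENNReal.mul_inv_cancel (by simp) (by simp), one_pow,
          one_mul]

theorem ae_of_ae_level (P : Params) {p : X P → Prop}
    (h : ∀ m j, ∀ᵐ x ∂mu P, x ∈ X.level P m j → p x) : ∀ᵐ x ∂mu P, p x := by
  filter_upwards [ae_all_iff.2 fun m => ae_all_iff.2 (h m)] with x hx
  obtain ⟨m, hm⟩ := x.2.2.2
  obtain ⟨j, hj⟩ := Option.ne_none_iff_exists'.mp hm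
  exact hx m j hj

theorem ae_eventually_notMem_leaving (P : Params) :
    ∀ᵐ x ∂mu P, ∀ᶠ ℓ in atTop, x ∉ leaving P ℓ := by
  refine ae_of_ae_level P fun m j => ?_
  have hs : ∑' ℓ, mu P (leaving P (ℓ + (m + 1)) ∩ X.level P m j) ≠ ∞ := by
    have h1 : ∑' ℓ : ℕ, (3⁻¹ : ℝ≥0∞) ^ ℓ ≠ ∞ := by
      rw [ENNReal.tsum_geometric]
      exact ENNReal.inv_ne_top.2 (tsub_pos_of_lt (ENNReal.inv_lt_one.2 (by norm_num))).ne'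
    refine ne_top_of_le_ne_top h1 (ENNReal.tsum_le_tsum fun ℓ => ?_)
    refine (mu_leaving_inter_level_le P (by omega) (by omega)).trans ?_
    exact pow_le_pow_right_of_le_one' (ENNReal.inv_le_one.2 (by norm_num)) (by omega)
  filter_upwards [ae_eventually_notMem hs] with x hx hxm
  filter_upwards [(tendsto_sub_atTop_nat (m + 1)).eventually hx, eventually_ge_atTop (m + 1)]
    with ℓ h1 h2 hℓ
  rw [Nat.sub_add_cancel h2] at h1
  exact h1 ⟨hℓ, hxm⟩

/-- The normalizing constants of the law of large numbers. -/
noncomputable def norming (P : Params) (ℓ : ℕ) : ℕ := 3 ^ (P.n ℓ + 1) * windows P ℓ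

/-- The normalized occupation counts at time `time P ℓ`. -/
noncomputable def normOcc (P : Params) (B : Set (X P)) (ℓ : ℕ) (x : X P) : ℝ≥0∞ :=
  occupation (T P) B (time P ℓ) x / norming P ℓ

theorem le_windows (P : Params) {ℓ : ℕ} : ℓ ≤ windows P ℓ := by
  rw [windows, Nat.le_div_iff_mul_le (Nat.succ_pos _), time]
  refine le_trans ?_ (three_pow_le_height P (P.n ℓ + 1) ℓ)
  have h1 := P.height_pos (P.n ℓ + 1)
  have h2 : 2 * ℓ ≤ 3 ^ ℓ := by
    induction ℓ with
    | zero => simp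
    | succ ℓ ih =>
      rw [pow_succ]
      have := Nat.one_le_pow ℓ 3 (by norm_num)
      have ih := ih (P.height_pos _)
      omega
  calc ℓ * (P.height (P.n ℓ + 1) + 1) ≤ ℓ * (2 * P.height (P.n ℓ + 1)) :=
        Nat.mul_le_mul_left _ (by omega)
    _ = 2 * ℓ * P.height (P.n ℓ + 1) := by ring
    _ ≤ _ := Nat.mul_le_mul_right _ h2

/-- The level consists of `3^{n_ℓ+1-m}` levels of tower `n_ℓ+1`. Each is visited at least once per
window, and at most once per block of `h_{n_ℓ+1}` times; dividing by `norming` leaves `3^{-m}`, up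
to the ratio of the two counts. -/
theorem normOcc_level_bounds (P : Params) {m j ℓ : ℕ} (hj : j < P.height m) (hℓ : 1 ≤ ℓ)
    (hm : m ≤ ℓ) {x : X P} (hx : x ∉ leaving P ℓ) (hx' : x ∈ tower P ℓ) :
    (3⁻¹ : ℝ≥0∞) ^ m ≤ normOcc P (X.level P m j) ℓ x ∧
      normOcc P (X.level P m j) ℓ x ≤ (3⁻¹) ^ m *
        ((time P ℓ / P.height (P.n ℓ + 1) + 1 : ℕ) / (windows P ℓ : ℝ≥0∞)) := by
  have hn := P.n_lt_succ hℓ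
  have hn' := P.lt_n hℓ
  have hw : 1 ≤ windows P ℓ := hℓ.trans (le_windows P)
  obtain ⟨e, he⟩ : ∃ e, P.n ℓ + 1 = m + e := ⟨P.n ℓ + 1 - m, by omega⟩
  obtain ⟨d, hd⟩ : ∃ d, P.n (ℓ + 1) = P.n ℓ + 1 + d := ⟨P.n (ℓ + 1) - (P.n ℓ + 1), by omega⟩
  have hpad : ∀ q, P.n ℓ + 1 ≤ q → q < P.n ℓ + 1 + d → P.pad q = 0 := fun q h1 h2 =>
    pad_eq_zero P hℓ (by omega) (by omega)
  obtain ⟨y, hy⟩ := mem_tower.1 (tower_mono P (show ℓ ≤ P.n (ℓ + 1) by omega) hx')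
  have hyt : y + time P ℓ ≤ P.height (P.n (ℓ + 1)) := by
    by_contra! h
    exact hx ⟨y, hy, h⟩
  rw [hd] at hy hyt
  have hc := card_visits_level P (m := m) (j := j) (p := P.n ℓ + 1) (by omega) (time P ℓ) x
  have hJ := card_sublevels P hj e
  rw [← he] at hJ
  have hlow : 3 ^ e * windows P ℓ ≤ (visits P (X.level P m j) (time P ℓ) x).card := by
    rw [hc, ← hJ, ← smul_eq_mul]
    exact Finset.card_nsmul_le_sum _ _ _ fun i hi =>
      le_card_visits P (lt_of_mem_sublevels hi) hpad hy hyt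
  have hupp : (visits P (X.level P m j) (time P ℓ) x).card ≤
      3 ^ e * (time P ℓ / P.height (P.n ℓ + 1) + 1) := by
    rw [hc, ← hJ, ← smul_eq_mul]
    exact Finset.sum_le_card_nsmul _ _ _ fun i _ => card_visits_level_le P _ i _ x
  have h3 : (3⁻¹ : ℝ≥0∞) ^ m = 3 ^ e / 3 ^ (P.n ℓ + 1) := by
    rw [ENNReal.eq_div_iff (by simp) (by simp), he, pow_add, mul_right_comm, ← mul_pow,
      ENNReal.mul_inv_cancel (by simp) (by simp), one_pow, one_mul]
  have hw0 : (windows P ℓ : ℝ≥0∞) ≠ 0 := by exact_mod_cast (by omega : windows P ℓ ≠ 0)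
  rw [normOcc, norming, occupation_eq_card, h3]
  push_cast
  constructor
  · rw [ENNReal.le_div_iff_mul_le (Or.inl (by simp [hw0]))
      (Or.inl (ENNReal.mul_ne_top (by simp) (by simp))), ← mul_assoc,
      ENNReal.div_mul_cancel (by simp) (by simp)]
    exact_mod_cast hlow
  · rw [div_eq_mul_inv, ENNReal.mul_inv (by simp) (by simp), div_eq_mul_inv, div_eq_mul_inv]
    calc _ ≤ ((3 : ℝ≥0∞) ^ e * ((time P ℓ / P.height (P.n ℓ + 1) : ℕ) + 1)) *
          ((3 ^ (P.n ℓ + 1))⁻¹ * (windows P ℓ : ℝ≥0∞)⁻¹) :=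
          mul_le_mul_left (by exact_mod_cast hupp) _
      _ = _ := by ring

/-- The ratio compares division by `h` with division by `h + 1`, where `h = h_{n_ℓ+1}`; both `h` and
the number of windows tend to infinity. -/
theorem tendsto_window_ratio (P : Params) :
    Tendsto (fun ℓ => ((time P ℓ / P.height (P.n ℓ + 1) + 1 : ℕ) : ℝ≥0∞) / (windows P ℓ : ℝ≥0∞))
      atTop (𝓝 1) := by
  have hw : Tendsto (fun ℓ => ((windows P ℓ : ℕ) : ℝ)⁻¹) atTop (𝓝 0) :=
    tendsto_inv_atTop_nhds_zero_nat.comp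
      (tendsto_atTop_mono (fun ℓ => le_windows P) tendsto_id)
  have hh : Tendsto (fun ℓ => ((P.height (P.n ℓ + 1) : ℕ) : ℝ)⁻¹) atTop (𝓝 0) := by
    refine tendsto_inv_atTop_nhds_zero_nat.comp (tendsto_atTop_mono' _ ?_ tendsto_id)
    filter_upwards [eventually_ge_atTop 1] with ℓ hℓ
    have h1 := lt_height P (P.n ℓ + 1)
    have h2 := P.lt_n hℓ
    simp only [id]
    omega
  have hlim : Tendsto (fun ℓ => ENNReal.ofReal ((1 + ((windows P ℓ : ℕ) : ℝ)⁻¹) *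
      (1 + ((P.height (P.n ℓ + 1) : ℕ) : ℝ)⁻¹) + ((windows P ℓ : ℕ) : ℝ)⁻¹)) atTop (𝓝 1) := by
    have := ENNReal.tendsto_ofReal (((tendsto_const_nhds (x := (1 : ℝ))).add hw).mul
      ((tendsto_const_nhds (x := (1 : ℝ))).add hh) |>.add hw)
    simpa using this
  refine tendsto_of_tendsto_of_tendsto_of_le_of_le' tendsto_const_nhds hlim ?_ ?_
  · filter_upwards [eventually_ge_atTop 1] with ℓ hℓ
    have hw1 : 1 ≤ windows P ℓ := hℓ.trans (le_windows P)
    rw [ENNReal.le_div_iff_mul_le (Or.inl (by simp; omega)) (Or.inl (by simp)), one_mul]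
    have : windows P ℓ ≤ time P ℓ / P.height (P.n ℓ + 1) :=
      Nat.div_le_div_left (Nat.le_succ _) (P.height_pos _)
    exact_mod_cast this.trans (Nat.le_succ _)
  · filter_upwards [eventually_ge_atTop 1] with ℓ hℓ
    have hw1 : 1 ≤ windows P ℓ := hℓ.trans (le_windows P)
    have hwr : (0 : ℝ) < windows P ℓ := by exact_mod_cast hw1
    have hhr : (0 : ℝ) < P.height (P.n ℓ + 1) := by exact_mod_cast P.height_pos _
    rw [← ENNReal.ofReal_natCast (windows P ℓ), ← ENNReal.ofReal_natCast,
      ← ENNReal.ofReal_div_of_pos hwr]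
    refine ENNReal.ofReal_le_ofReal ?_
    rw [div_le_iff₀ hwr]
    have h1 : time P ℓ < (windows P ℓ + 1) * (P.height (P.n ℓ + 1) + 1) := by
      rw [Nat.mul_comm]
      exact Nat.lt_mul_div_succ _ (Nat.succ_pos _)
    have h1' : (time P ℓ : ℝ) ≤ (windows P ℓ + 1) * (P.height (P.n ℓ + 1) + 1) := by
      exact_mod_cast h1.le
    have h2 : ((time P ℓ / P.height (P.n ℓ + 1) : ℕ) : ℝ) ≤
        (windows P ℓ + 1) * (1 + ((P.height (P.n ℓ + 1) : ℕ) : ℝ)⁻¹) := by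
      refine Nat.cast_div_le.trans ?_
      rw [div_le_iff₀ hhr, mul_assoc, add_mul (1 : ℝ), inv_mul_cancel₀ hhr.ne', one_mul]
      exact h1'
    push_cast
    calc _ ≤ (windows P ℓ + 1) * (1 + ((P.height (P.n ℓ + 1) : ℕ) : ℝ)⁻¹) + 1 := by linarith
      _ = _ := by field_simp

theorem ae_tendsto_normOcc_level (P : Params) :
    ∀ᵐ x ∂mu P, ∀ m j, Tendsto (fun ℓ => normOcc P (X.level P m j) ℓ x) atTop
      (𝓝 (mu P (X.level P m j))) := by
  filter_upwards [ae_eventually_notMem_leaving P] with x hx m j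
  rcases Nat.lt_or_ge j (P.height m) with hj | hj
  · rw [mu_level P hj]
    obtain ⟨q, hq⟩ := Set.mem_iUnion.1 ((iUnion_tower P).symm ▸ Set.mem_univ x)
    have hb : ∀ᶠ ℓ in atTop, (3⁻¹ : ℝ≥0∞) ^ m ≤ normOcc P (X.level P m j) ℓ x ∧
      normOcc P (X.level P m j) ℓ x ≤ (3⁻¹) ^ m *
        ((time P ℓ / P.height (P.n ℓ + 1) + 1 : ℕ) / (windows P ℓ : ℝ≥0∞)) := by
      filter_upwards [hx, eventually_ge_atTop 1, eventually_ge_atTop m, eventually_ge_atTop q]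
        with ℓ h1 h2 h3 h4
      exact normOcc_level_bounds P hj h2 h3 h1 (tower_mono P h4 hq)
    have hlim := ENNReal.Tendsto.const_mul (a := (3⁻¹ : ℝ≥0∞) ^ m) (tendsto_window_ratio P)
      (Or.inr (by simp))
    rw [mul_one] at hlim
    exact tendsto_of_tendsto_of_tendsto_of_le_of_le' tendsto_const_nhds hlim
      (hb.mono fun _ h => h.1) (hb.mono fun _ h => h.2)
  · simp [level_eq_empty hj, normOcc, occupation]

/-! ### The law of large numbers -/

theorem occupation_mono {Ω : Type*} (f : Ω → Ω) {A B : Set Ω} (h : A ⊆ B) (r : ℕ) (x : Ω) :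
    occupation f A r x ≤ occupation f B r x :=
  Finset.sum_le_sum fun _ _ => Set.indicator_le_indicator_of_subset h (fun _ => zero_le) _

theorem occupation_add_diff {Ω : Type*} (f : Ω → Ω) {A B : Set Ω} (h : A ⊆ B) (r : ℕ) (x : Ω) :
    occupation f A r x + occupation f (B \ A) r x = occupation f B r x := by
  rw [occupation, occupation, occupation, ← Finset.sum_add_distrib]
  refine Finset.sum_congr rfl fun j _ => ?_
  by_cases h1 : f^[j] x ∈ A
  · simp [h1, h h1]
  · by_cases h2 : f^[j] x ∈ B <;> simp [h1, h2]

theorem normOcc_mono (P : Params) {A B : Set (X P)} (h : A ⊆ B) (ℓ : ℕ) (x : X P) :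
    normOcc P A ℓ x ≤ normOcc P B ℓ x :=
  ENNReal.div_le_div_right (occupation_mono _ h _ _) _

theorem normOcc_add_diff (P : Params) {A B : Set (X P)} (h : A ⊆ B) (ℓ : ℕ) (x : X P) :
    normOcc P A ℓ x + normOcc P (B \ A) ℓ x = normOcc P B ℓ x := by
  rw [normOcc, normOcc, normOcc, ← ENNReal.add_div, occupation_add_diff _ h]

theorem normOcc_empty (P : Params) (ℓ : ℕ) (x : X P) : normOcc P ∅ ℓ x = 0 := by
  simp [normOcc, occupation]

theorem normOcc_biUnion (P : Params) {ι : Type*} (J : Finset ι) (f : ι → Set (X P))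
    (hf : ∀ i ∈ J, ∀ j ∈ J, i ≠ j → Disjoint (f i) (f j)) (ℓ : ℕ) (x : X P) :
    normOcc P (⋃ i ∈ J, f i) ℓ x = ∑ i ∈ J, normOcc P (f i) ℓ x := by
  simp only [normOcc, occupation_eq_card, card_visits_biUnion P J f hf, Nat.cast_sum,
    div_eq_mul_inv, Finset.sum_mul]

/-- By the maximal inequality, the points of a level `A` where the counts of every `D k` at some
time exceed `c` times those of `A` have measure at most `mu (D k) / c` for all `k`, hence zero. -/
theorem ae_exists_eventually_normOcc_le (P : Params) {D : ℕ → Set (X P)}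
    (hD : ∀ k, MeasurableSet (D k)) (htop : ∀ k, mu P (D k) ≠ ∞)
    (hlim : Tendsto (fun k => mu P (D k)) atTop (𝓝 0)) :
    ∀ᵐ x ∂mu P, ∀ c : ℝ≥0, 0 < c →
      ∃ k, ∀ᶠ ℓ in atTop, normOcc P (D k) ℓ x ≤ c := by
  -- Countably many constants suffice. The factor 2 bounds the normalized counts of `A`, which
  -- converge to `mu A ≤ 1`.
  have key : ∀ i : ℕ, ∀ᵐ x ∂mu P,
      ∃ k, ∀ᶠ ℓ in atTop, normOcc P (D k) ℓ x ≤ ((i + 1 : ℝ≥0)⁻¹ : ℝ≥0) * 2 := fun i => by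
    set c : ℝ≥0 := (i + 1 : ℝ≥0)⁻¹ with hc
    have hc0 : c ≠ 0 := by positivity
    refine ae_of_ae_level P fun m j => ?_
    set A := X.level P m j with hA
    have hA1 : mu P A ≤ 1 := (mu_level_le P m j).trans
      (pow_le_one' (ENNReal.inv_le_one.2 (by norm_num)) m)
    set Z : Set (X P) := {x | x ∈ A ∧ ∀ k, ∃ n,
      c * occupation (T P) A n x < occupation (T P) (D k) n x} with hZ
    have hZ0 : mu P Z = 0 := by
      have h1 : ∀ k, c * mu P Z ≤ mu P (D k) := fun k =>
        (mul_le_mul_right (measure_mono (t := A ∩ {x | ∃ n, c * occupation (T P) A n x <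
            occupation (T P) (D k) n x}) fun x hx => ⟨hx.1, hx.2 k⟩) _).trans
          (measure_exists_lt_occupation_le (measurePreserving_T P) (measurableSet_level P m j)
            (hD k) (mu_level_ne_top P m j) (htop k) c)
      have h2 : c * mu P Z = 0 := le_antisymm (ge_of_tendsto' hlim h1) zero_le
      exact (mul_eq_zero.1 h2).resolve_left (by simpa using hc0)
    filter_upwards [measure_eq_zero_iff_ae_notMem.1 hZ0, ae_tendsto_normOcc_level P] with x hx hx' hxA
    have h3 : ∃ k, ∀ n, occupation (T P) (D k) n x ≤ c * occupation (T P) A n x := by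
      by_contra! h
      exact hx ⟨hxA, h⟩
    obtain ⟨k, hk⟩ := h3
    refine ⟨k, ?_⟩
    filter_upwards [(hx' m j).eventually_lt_const (hA1.trans_lt ENNReal.one_lt_two)] with ℓ hℓ
    refine le_trans ?_ (mul_le_mul_right hℓ.le (c : ℝ≥0∞))
    simp only [normOcc]
    rw [← mul_div_assoc]
    exact ENNReal.div_le_div_right (hk _) _
  filter_upwards [ae_all_iff.2 key] with x hx c hc
  obtain ⟨i, hi⟩ := exists_nat_one_div_lt (K := ℝ≥0) (half_pos hc)
  obtain ⟨k, hk⟩ := hx i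
  refine ⟨k, hk.mono fun ℓ h => h.trans ?_⟩
  rw [one_div, lt_div_iff₀ two_pos] at hi
  exact_mod_cast hi.le

/-- The lower bound is monotonicity. The upper bound is trivial if `mu B = ∞`; otherwise the
remainders `B \ F k` have measure tending to zero, so their counts are negligible. -/
theorem ae_tendsto_normOcc_of_exhaustion (P : Params) {B : Set (X P)} {F : ℕ → Set (X P)}
    (hF : ∀ k, MeasurableSet (F k)) (hmono : Monotone F) (hFB : ⋃ k, F k = B)
    (hlim : ∀ k, ∀ᵐ x ∂mu P, Tendsto (fun ℓ => normOcc P (F k) ℓ x) atTop (𝓝 (mu P (F k)))) :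
    ∀ᵐ x ∂mu P, Tendsto (fun ℓ => normOcc P B ℓ x) atTop (𝓝 (mu P B)) := by
  have hB : MeasurableSet B := hFB ▸ MeasurableSet.iUnion hF
  have hsub : ∀ k, F k ⊆ B := fun k => hFB ▸ Set.subset_iUnion F k
  have hmu : Tendsto (fun k => mu P (F k)) atTop (𝓝 (mu P B)) :=
    hFB ▸ tendsto_measure_iUnion_atTop hmono
  have hlow : ∀ᵐ x ∂mu P, mu P B ≤ liminf (fun ℓ => normOcc P B ℓ x) atTop := by
    filter_upwards [ae_all_iff.2 hlim] with x hx
    refine le_of_tendsto' hmu fun k => ?_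
    rw [← (hx k).liminf_eq]
    exact liminf_le_liminf (Eventually.of_forall fun ℓ => normOcc_mono P (hsub k) ℓ x)
  have hupp : ∀ᵐ x ∂mu P, limsup (fun ℓ => normOcc P B ℓ x) atTop ≤ mu P B := by
    by_cases htop : mu P B = ∞
    · exact ae_of_all _ fun x => htop ▸ le_top
    have hDt : ∀ k, mu P (B \ F k) ≠ ∞ := fun k => measure_ne_top_of_subset Set.sdiff_subset htop
    have hD0 : Tendsto (fun k => mu P (B \ F k)) atTop (𝓝 0) := by
      have h := tendsto_measure_iInter_atTop (μ := mu P) (s := fun k => B \ F k)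
        (fun k => (hB.diff (hF k)).nullMeasurableSet)
        (fun k l hkl => Set.sdiff_subset_sdiff_right (hmono hkl)) ⟨0, hDt 0⟩
      rwa [← Set.sdiff_iUnion, hFB, Set.sdiff_self, measure_empty] at h
    filter_upwards [ae_all_iff.2 hlim,
      ae_exists_eventually_normOcc_le P (fun k => hB.diff (hF k)) hDt hD0] with x hx hx'
    refine ENNReal.le_of_forall_pos_le_add fun c hc _ => ?_
    obtain ⟨k, hk⟩ := hx' c hc
    calc limsup (fun ℓ => normOcc P B ℓ x) atTop
        ≤ limsup (fun ℓ => normOcc P (F k) ℓ x + c) atTop := by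
          refine limsup_le_limsup (hk.mono fun ℓ h => ?_)
          simp only [← normOcc_add_diff P (hsub k)]
          exact add_le_add_right h _
      _ = mu P (F k) + c := ((hx k).add_const _).limsup_eq
      _ ≤ mu P B + c := add_le_add_left (measure_mono (hsub k)) _
  filter_upwards [hlow, hupp] with x h1 h2
  exact tendsto_of_le_liminf_of_limsup_le h1 h2

theorem ae_tendsto_normOcc_biUnion (P : Params) {ι : Type*} (J : Finset ι) (f : ι → Set (X P))
    (hfm : ∀ i ∈ J, MeasurableSet (f i))
    (hf : ∀ i ∈ J, ∀ j ∈ J, i ≠ j → Disjoint (f i) (f j))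
    (h : ∀ i ∈ J, ∀ᵐ x ∂mu P, Tendsto (fun ℓ => normOcc P (f i) ℓ x) atTop (𝓝 (mu P (f i)))) :
    ∀ᵐ x ∂mu P, Tendsto (fun ℓ => normOcc P (⋃ i ∈ J, f i) ℓ x) atTop
      (𝓝 (mu P (⋃ i ∈ J, f i))) := by
  filter_upwards [(ae_ball_iff J.countable_toSet).2 h] with x hx
  simp_rw [normOcc_biUnion P J f hf]
  rw [measure_biUnion_finset (fun i hi j hj hij => hf i hi j hj hij) hfm]
  exact tendsto_finsetSum _ fun i hi => hx i hi

/-- Dynkin's argument is confined to one level, whose finite measure allows the subtraction in the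
complement step. -/
theorem ae_tendsto_normOcc_inter_level (P : Params) (m j : ℕ) {B : Set (X P)}
    (hB : MeasurableSet B) :
    ∀ᵐ x ∂mu P, Tendsto (fun ℓ => normOcc P (B ∩ X.level P m j) ℓ x) atTop
      (𝓝 (mu P (B ∩ X.level P m j))) := by
  induction B, hB using MeasurableSpace.induction_on_inter (generateFrom_levels P)
    (isPiSystem_levels P) with
  | empty => simp [normOcc_empty]
  | basic t ht =>
    obtain ⟨⟨p, i⟩, rfl⟩ := ht
    rcases level_inter_level (P := P) p i m j with ⟨q, a, h⟩ | h
    · simp only [h]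
      filter_upwards [ae_tendsto_normOcc_level P] with x hx using hx q a
    · simp [h, normOcc_empty]
  | compl t htm ih =>
    set A := X.level P m j
    have hAm : MeasurableSet A := measurableSet_level P m j
    have hAt : mu P A ≠ ∞ := mu_level_ne_top P m j
    have hc : tᶜ ∩ A = A \ (t ∩ A) := by
      ext x; simp only [Set.mem_inter_iff, Set.mem_compl_iff, Set.mem_sdiff]; tauto
    have ht : mu P (t ∩ A) ≠ ∞ := measure_ne_top_of_subset Set.inter_subset_right hAt
    rw [hc, measure_sdiff Set.inter_subset_right (htm.inter hAm).nullMeasurableSet ht]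
    filter_upwards [ih, ae_tendsto_normOcc_level P] with x hx hx'
    refine Tendsto.congr' ?_ (ENNReal.Tendsto.sub (hx' m j) hx (Or.inl hAt))
    have hfin : ∀ᶠ ℓ in atTop, normOcc P (t ∩ A) ℓ x < ∞ :=
      hx.eventually_lt_const ht.lt_top
    filter_upwards [hfin] with ℓ hℓ
    rw [← normOcc_add_diff P (Set.inter_subset_right : t ∩ A ⊆ A), ENNReal.add_sub_cancel_left hℓ.ne]
  | iUnion f hd hfm ih =>
    set A := X.level P m j
    have hAm : MeasurableSet A := measurableSet_level P m j
    refine ae_tendsto_normOcc_of_exhaustion P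
      (F := fun k => ⋃ i ∈ Finset.range k, f i ∩ A) (fun k => ?_) (fun k l hkl => ?_) ?_ fun k => ?_
    · exact Finset.measurableSet_biUnion _ fun i _ => (hfm i).inter hAm
    · exact Set.biUnion_subset_biUnion_left (Finset.range_mono hkl)
    · ext x
      simp only [Set.mem_iUnion, Set.mem_inter_iff, Finset.mem_range, exists_prop]
      exact ⟨fun ⟨k, i, _, h1, h2⟩ => ⟨⟨i, h1⟩, h2⟩,
        fun ⟨⟨i, h1⟩, h2⟩ => ⟨i + 1, i, Nat.lt_succ_self i, h1, h2⟩⟩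
    · exact ae_tendsto_normOcc_biUnion P _ _ (fun i _ => (hfm i).inter hAm)
        (fun i _ i' _ h => (hd h).mono Set.inter_subset_left Set.inter_subset_left)
        fun i _ => ih i

theorem ae_tendsto_normOcc (P : Params) {B : Set (X P)} (hB : MeasurableSet B) :
    ∀ᵐ x ∂mu P, Tendsto (fun ℓ => normOcc P B ℓ x) atTop (𝓝 (mu P B)) := by
  refine ae_tendsto_normOcc_of_exhaustion P (F := fun k => B ∩ tower P k)
    (fun k => hB.inter (measurableSet_tower P k))
    (fun k l hkl => Set.inter_subset_inter_right B (tower_mono P hkl)) ?_ fun k => ?_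
  · rw [← Set.inter_iUnion, iUnion_tower, Set.inter_univ]
  · simp only [tower, Set.inter_iUnion₂]
    exact ae_tendsto_normOcc_biUnion P _ _ (fun i _ => hB.inter (measurableSet_level P k i))
      (fun i _ i' _ h => (level_disjoint h).mono Set.inter_subset_right Set.inter_subset_right)
      fun i _ => ae_tendsto_normOcc_inter_level P k i hB

/-- The law of large numbers: the lower limit of the normalized counts of ones. -/
noncomputable def lawOfLargeNumbers (P : Params) (ω : ℕ → Fin 2) : ℝ≥0∞ :=
  liminf (fun ℓ => (∑ j ∈ Finset.range (time P ℓ), ((ω j : ℕ) : ℝ≥0∞)) / norming P ℓ) atTop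

/-- A lower limit is defined and measurable on all 0-1 sequences, and agrees with the almost sure
limit where that exists. -/
theorem isMeasurableLLN_lawOfLargeNumbers (P : Params) :
    IsMeasurableLLN (T P) (mu P) (lawOfLargeNumbers P) := by
  refine ⟨Measurable.liminf fun ℓ => ?_, fun B hB => ?_⟩
  · refine Measurable.div_const (Finset.measurable_sum _ fun j _ => ?_) _
    exact (measurable_of_countable fun a : Fin 2 => ((a : ℕ) : ℝ≥0∞)).comp (measurable_pi_apply j)
  · filter_upwards [ae_tendsto_normOcc P hB] with x hx
    rw [← hx.liminf_eq, lawOfLargeNumbers]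
    congr 1
    ext ℓ
    rw [normOcc, occupation]
    congr 1
    refine Finset.sum_congr rfl fun j _ => ?_
    by_cases h : (T P)^[j] x ∈ B <;> simp [h]

theorem rationallyErgodic_T (P : Params) : RationallyErgodic (T P) (mu P) :=
  ⟨sigmaFinite_mu P, conservative_T P, ergodic_T P, _, renyiInequality_base P⟩

end NearlyFiniteChacon

theorem mainTheorem3 (P : NearlyFiniteChacon.Params) :
    RationallyErgodic (NearlyFiniteChacon.T P) (NearlyFiniteChacon.mu P) ∧
    RenyiInequality (NearlyFiniteChacon.T P) (NearlyFiniteChacon.mu P)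
      (NearlyFiniteChacon.X.level P 0 0) ∧
    ∃ L : (ℕ → Fin 2) → ENNReal,
      IsMeasurableLLN (NearlyFiniteChacon.T P) (NearlyFiniteChacon.mu P) L :=
  ⟨NearlyFiniteChacon.rationallyErgodic_T P, NearlyFiniteChacon.renyiInequality_base P, _,
    NearlyFiniteChacon.isMeasurableLLN_lawOfLargeNumbers P⟩
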